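/- Let $\rho$ be any probability distribution on the unit sphere $\mathcal S^{d-1}\subset\mathbb R^d$, let $\mathcal K(x,s)=\frac{\langle x,s\rangle}{2\pi}\bigl(\pi-\arccos\langle x,s\rangle\bigr)$ be the arc-cosine kernel, and let $L_{\mathcal K}$ be the integral operator $(L_{\mathcal K}f)(x)=\int_{\mathcal S^{d-1}}\mathcal K(x,s)f(s)\,\mathrm d\rho(s)$ on $L^2(\mathcal S^{d-1},\rho)$. For $n,m\ge 1$ and $\nu>0$ let $x_1,\dots,x_n\sim\rho$, $w_1,\dots,w_m\sim\mathcal N(0,\nu^2 I_d)$ and $a_1,\dots,a_m$ uniform on $\{-1,1\}$ be mutually independent, and let $H=H^++H^-$, where $H^{\pm}$ are the $n\times n$ matrices with entries $$H^{\pm}_{ii'}=\frac{1}{nm}\langle x_i,x_{i'}\rangle\sum_{j:\,a_j=\pm1}\mathbf 1\{\langle w_j,x_{i'}\rangle>0\}\,\mathbf 1\{\langle w_j,x_i\rangle>0\}.$$ Let $\tilde\lambda_1\ge\dots\ge\tilde\lambda_n$ be the eigenvalues of $H$, let $\lambda_{\min}(H)=\tilde\lambda_n$, and put $\tilde\lambda_i=0$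 for $i>n$. Then there is a sequence of non-negative real numbers $\lambda_1\ge\lambda_2\ge\cdots$, depending only on $\rho$, with $\lim_{i\to\infty}\lambda_i=0$, namely the spectrum of $L_{\mathcal K}$ (the nonzero eigenvalues repeated according to multiplicity, followed by zeros if there are only finitely many), such that the following hold. 1. For all $n,m\ge1$, $\nu>0$ and $\delta\in(0,1)$, with probability at least $1-\delta$, $$\sup_{i\ge1}|\lambda_i-\tilde\lambda_i|\le\sqrt{\frac{\log(2n^2/\delta)}{2m}}+\sqrt{\frac{8\log(4/\delta)}{n}}.$$ 2. If $m=m_n$ satisfies $m_n=\omega(\log n)$ (and $\nu=\nu_n>0$ is arbitrary), then $\lambda_{\min}(H)\to0$ in probability as $n\to\infty$. -/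

import Mathlib

open MeasureTheory ProbabilityTheory Filter Topology
open scoped RealInnerProductSpace

/-- The ambient Euclidean space `ℝ^d` of features and of first-layer weights. -/
abbrev Feat (d : ℕ) : Type := EuclideanSpace ℝ (Fin d)

/-- The unit sphere `S^{d-1}` in `ℝ^d`, where the feature vectors live. -/
abbrev Sph (d : ℕ) : Type := Metric.sphere (0 : EuclideanSpace ℝ (Fin d)) 1

/-! ### The integral operator of the arc-cosine kernel -/

/-- The arc-cosine kernel `𝒦(x, s) = ⟪x, s⟫ / (2π) * (π - arccos ⟪x, s⟫)` on the sphere. -/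
noncomputable def arcKernel {d : ℕ} (x s : Sph d) : ℝ :=
  ⟪(x : Feat d), (s : Feat d)⟫ / (2 * Real.pi) *
    (Real.pi - Real.arccos ⟪(x : Feat d), (s : Feat d)⟫)

theorem continuous_arcKernel {d : ℕ} :
    Continuous (fun p : Sph d × Sph d => arcKernel p.1 p.2) := by
  unfold arcKernel
  have h : Continuous (fun p : Sph d × Sph d => ⟪(p.1 : Feat d), (p.2 : Feat d)⟫) := by
    fun_prop
  exact (h.div_const _).mul (continuous_const.sub (Real.continuous_arccos.comp h))

theorem abs_arcKernel_le {d : ℕ} (x s : Sph d) : |arcKernel x s| ≤ 1 / 2 := by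
  have hx : ‖(x : Feat d)‖ = 1 := by simp
  have hs : ‖(s : Feat d)‖ = 1 := by simp
  have h1 : |⟪(x : Feat d), (s : Feat d)⟫| ≤ 1 := by
    simpa [hx, hs] using abs_real_inner_le_norm (x : Feat d) (s : Feat d)
  have hp := Real.pi_pos
  have h2 : |Real.pi - Real.arccos ⟪(x : Feat d), (s : Feat d)⟫| ≤ Real.pi := by
    have ha := Real.arccos_nonneg ⟪(x : Feat d), (s : Feat d)⟫
    have hb := Real.arccos_le_pi ⟪(x : Feat d), (s : Feat d)⟫
    rw [abs_le]
    constructor <;> linarith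
  unfold arcKernel
  rw [abs_mul, abs_div, abs_of_pos (by positivity : (0 : ℝ) < 2 * Real.pi)]
  calc |⟪(x : Feat d), (s : Feat d)⟫| / (2 * Real.pi) *
        |Real.pi - Real.arccos ⟪(x : Feat d), (s : Feat d)⟫|
      ≤ 1 / (2 * Real.pi) * Real.pi := by gcongr
    _ = 1 / 2 := by field_simp

section IntegralOperator

variable {d : ℕ} (ρ : Measure (Sph d)) [IsProbabilityMeasure ρ]

theorem integrable_of_L2 (f : Lp ℝ 2 ρ) : Integrable f ρ :=
  (Lp.memLp f).integrable (by norm_num)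

theorem integrable_arcKernel_mul (f : Lp ℝ 2 ρ) (x : Sph d) :
    Integrable (fun s => arcKernel x s * f s) ρ := by
  refine (integrable_of_L2 ρ f).bdd_mul (c := 1 / 2) ?_ ?_
  · have h : Continuous (fun s : Sph d => arcKernel x s) :=
      continuous_arcKernel.comp (by fun_prop : Continuous (fun s : Sph d => (x, s)))
    exact h.aestronglyMeasurable
  · exact Eventually.of_forall fun s => by simpa using abs_arcKernel_le x s

/-- The function `x ↦ ∫ 𝒦(x, s) f(s) dρ(s)`. -/
noncomputable def arcIntegral (f : Lp ℝ 2 ρ) (x : Sph d) : ℝ :=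
  ∫ s, arcKernel x s * f s ∂ρ

theorem abs_arcIntegral_le (f : Lp ℝ 2 ρ) (x : Sph d) : ‖arcIntegral ρ f x‖ ≤ 1 / 2 * ‖f‖ := by
  have h1 : ‖arcIntegral ρ f x‖ ≤ ∫ s, 1 / 2 * ‖f s‖ ∂ρ := by
    refine norm_integral_le_of_norm_le ((integrable_of_L2 ρ f).norm.const_mul _) ?_
    refine Eventually.of_forall fun s => ?_
    rw [norm_mul]
    gcongr
    exact abs_arcKernel_le x s
  have h2 : ∫ s, ‖f s‖ ∂ρ ≤ ‖f‖ := by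
    rw [integral_norm_eq_lintegral_enorm (Lp.aestronglyMeasurable f), Lp.norm_def,
      ← eLpNorm_one_eq_lintegral_enorm]
    refine ENNReal.toReal_mono (Lp.eLpNorm_ne_top f) ?_
    exact eLpNorm_le_eLpNorm_of_exponent_le (by norm_num) (Lp.aestronglyMeasurable f)
  rw [integral_const_mul] at h1
  linarith

theorem memLp_arcIntegral (f : Lp ℝ 2 ρ) : MemLp (arcIntegral ρ f) 2 ρ := by
  refine MemLp.of_bound (C := 1 / 2 * ‖f‖) ?_ (Eventually.of_forall (abs_arcIntegral_le ρ f))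
  have h : StronglyMeasurable (fun p : Sph d × Sph d => arcKernel p.1 p.2 * f p.2) :=
    continuous_arcKernel.stronglyMeasurable.mul
      ((Lp.stronglyMeasurable f).comp_measurable measurable_snd)
  exact (h.integral_prod_right' (ν := ρ)).aestronglyMeasurable

/-- The integral operator `(L_𝒦 f)(x) = ∫ 𝒦(x, s) f(s) dρ(s)` on `L²(S^{d-1}, ρ)`. -/
noncomputable def arcOperator : Lp ℝ 2 ρ →L[ℝ] Lp ℝ 2 ρ :=
  LinearMap.mkContinuous
    { toFun := fun f => (memLp_arcIntegral ρ f).toLp (arcIntegral ρ f)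
      map_add' := fun f g => by
        rw [← MemLp.toLp_add]
        congr 1
        funext x
        simp only [arcIntegral, Pi.add_apply]
        rw [← integral_add (integrable_arcKernel_mul ρ f x) (integrable_arcKernel_mul ρ g x)]
        refine integral_congr_ae ?_
        filter_upwards [Lp.coeFn_add f g] with s hs
        rw [hs, Pi.add_apply, mul_add]
      map_smul' := fun c f => by
        rw [RingHom.id_apply, ← MemLp.toLp_const_smul]
        congr 1
        funext x
        simp only [arcIntegral, Pi.smul_apply, smul_eq_mul]
        rw [← integral_const_mul]
        refine integral_congr_ae ?_
        filter_upwards [Lp.coeFn_smul c f] with s hs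
        rw [hs, Pi.smul_apply, smul_eq_mul]
        ring }
    (1 / 2)
    (fun f => by
      refine (Lp.norm_le_of_ae_bound (C := 1 / 2 * ‖f‖) (by positivity) ?_).trans ?_
      · filter_upwards [(memLp_arcIntegral ρ f).coeFn_toLp] with x hx
        change ‖((memLp_arcIntegral ρ f).toLp (arcIntegral ρ f)) x‖ ≤ _
        rw [hx]
        exact abs_arcIntegral_le ρ f x
      · simp [measureUnivNNReal])

/-- Almost everywhere, `arcOperator ρ f` is given by the defining integral. -/
theorem coeFn_arcOperator (f : Lp ℝ 2 ρ) :
    arcOperator ρ f =ᵐ[ρ] fun x => ∫ s, arcKernel x s * f s ∂ρ :=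
  (memLp_arcIntegral ρ f).coeFn_toLp

end IntegralOperator

/-- `lam 0 ≥ lam 1 ≥ …` is the spectrum of the operator `T`, in non-increasing order: a
non-increasing sequence of non-negative reals with limit zero whose nonzero values are exactly the
nonzero points of the spectrum of `T`, each nonzero value being repeated as often as its
multiplicity (the dimension of its eigenspace). If `T` has only finitely many nonzero eigenvalues,
the sequence ends in zeros. -/
structure IsSpectralSequence {F : Type} [NormedAddCommGroup F] [NormedSpace ℝ F]
    (T : F →L[ℝ] F) (lam : ℕ → ℝ) : Prop where
  antitone : Antitone lam
  nonneg : ∀ i, 0 ≤ lam i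
  tendsto_zero : Tendsto lam atTop (𝓝 0)
  spectrum_eq : spectrum ℝ T \ {0} = Set.range lam \ {0}
  multiplicity : ∀ μ : ℝ, μ ≠ 0 →
    Module.rank ℝ (Module.End.eigenspace (T : F →ₗ[ℝ] F) μ) = Cardinal.mk {i : ℕ // lam i = μ}

/-! ### The random matrix of the network at initialization -/

/-- For first-layer weights `w`, features `x` and a set `J` of neurons, the matrix with entries
`1 / (n m) * ⟪x_i, x_{i'}⟫ * ∑_{j ∈ J} 𝟙{⟪w_j, x_{i'}⟫ > 0} 𝟙{⟪w_j, x_i⟫ > 0}`. -/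
noncomputable def neuronGram {d n m : ℕ} (J : Finset (Fin m)) (w : Fin m → Feat d)
    (x : Fin n → Sph d) : Matrix (Fin n) (Fin n) ℝ :=
  Matrix.of fun i i' =>
    1 / ((n : ℝ) * (m : ℝ)) * ⟪(x i : Feat d), (x i' : Feat d)⟫ *
      ∑ j ∈ J, (if 0 < ⟪w j, (x i' : Feat d)⟫ then (1 : ℝ) else 0) *
        (if 0 < ⟪w j, (x i : Feat d)⟫ then (1 : ℝ) else 0)

/-- `H⁺`: the sum is over the neurons with output weight `a_j = 1`. -/
noncomputable def Hplus {d n m : ℕ} (a : Fin m → ℤˣ) (w : Fin m → Feat d)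
    (x : Fin n → Sph d) : Matrix (Fin n) (Fin n) ℝ :=
  neuronGram {j | a j = 1} w x

/-- `H⁻`: the sum is over the neurons with output weight `a_j = -1`. -/
noncomputable def Hminus {d n m : ℕ} (a : Fin m → ℤˣ) (w : Fin m → Feat d)
    (x : Fin n → Sph d) : Matrix (Fin n) (Fin n) ℝ :=
  neuronGram {j | a j = -1} w x

/-- `H = H⁺ + H⁻`. -/
noncomputable def Hmat {d n m : ℕ} (a : Fin m → ℤˣ) (w : Fin m → Feat d)
    (x : Fin n → Sph d) : Matrix (Fin n) (Fin n) ℝ :=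
  Hplus a w x + Hminus a w x

theorem neuronGram_isHermitian {d n m : ℕ} (J : Finset (Fin m)) (w : Fin m → Feat d)
    (x : Fin n → Sph d) : (neuronGram J w x).IsHermitian := by
  refine Matrix.IsHermitian.ext fun i i' => ?_
  simp only [neuronGram, Matrix.of_apply, star_trivial]
  rw [real_inner_comm]
  congr 1
  exact Finset.sum_congr rfl fun j _ => mul_comm _ _

theorem Hmat_isHermitian {d n m : ℕ} (a : Fin m → ℤˣ) (w : Fin m → Feat d)
    (x : Fin n → Sph d) : (Hmat a w x).IsHermitian :=
  (neuronGram_isHermitian _ w x).add (neuronGram_isHermitian _ w x)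

/-- The eigenvalues `λ̃_0 ≥ λ̃_1 ≥ … ≥ λ̃_{n-1}` of `H` in non-increasing order, with multiplicity,
continued by `0` for indices `≥ n`. -/
noncomputable def Heig {d n m : ℕ} (a : Fin m → ℤˣ) (w : Fin m → Feat d)
    (x : Fin n → Sph d) (i : ℕ) : ℝ :=
  if h : i < n then
    (Hmat_isHermitian a w x).eigenvalues₀ ⟨i, by simpa using h⟩
  else 0

/-- The smallest eigenvalue of `H` (for `n ≥ 1`). -/
noncomputable def HeigMin {d n m : ℕ} (a : Fin m → ℤˣ) (w : Fin m → Feat d)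
    (x : Fin n → Sph d) : ℝ :=
  ⨅ i : Fin n, (Hmat_isHermitian a w x).eigenvalues i

/-- The joint law of the data set and the initialization: `x_1, …, x_n` i.i.d. with law `ρ`,
`w_1, …, w_m` i.i.d. with law `N(0, ν² I)`, `a_1, …, a_m` i.i.d. uniform on `{-1, 1}`, all
independent. -/
noncomputable def jointLaw {d : ℕ} (ρ : Measure (Sph d)) (ν : ℝ) (n m : ℕ) :
    Measure ((Fin n → Sph d) × (Fin m → Feat d) × (Fin m → ℤˣ)) :=
  (Measure.pi fun _ : Fin n => ρ).prod
    ((Measure.pi fun _ : Fin m =>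
        multivariateGaussian (0 : Feat d) (ν ^ 2 • (1 : Matrix (Fin d) (Fin d) ℝ))).prod
      (Measure.pi fun _ : Fin m => (PMF.uniformOfFintype ℤˣ).toMeasure))

/-!
The arc-cosine kernel has an explicit feature map. By Sheppard's formula
`P(⟪w, x⟫ > 0, ⟪w, s⟫ > 0) = (π - arccos ⟪x, s⟫) / (2π)` for Gaussian `w`, so that
`𝒦(x, s) = ⟪φ x, φ s⟫` in `L²(N(0, I); ℝ^d)`, where `φ x` is the function `w ↦ 𝟙{⟪w, x⟫ > 0} x`
(`inner_featureMap`).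

Let `A h = (x ↦ ⟪φ x, h⟫)`, an operator into `L²(ρ)`, and let `Aₙ` be the same operator for the
empirical measure of the sample. Then `A A†` is the kernel operator (`arcOperator_eq`), `Aₙ Aₙ†` is
the kernel matrix `(𝒦(x_i, x_j) / n)`, and both can be compared on the common space through
`A† A` and `Aₙ† Aₙ`, which have the same nonzero eigenvalues. Since `‖A h‖² = ⟪E φ⊗φ, h⊗h⟫`, the
two quadratic forms differ by at most the norm of the deviation of the empirical mean of `φ x ⊗ φ x`
from its expectation, and the min-max principle (`LowerForm.le_add`) turns this into a bound on the
eigenvalues that is uniform in the index (`abs_arcSpectrum_sub_eigSeq_le`). The deviation of the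
mean is controlled by a Hoeffding inequality in Hilbert space (`measure_norm_sum_ge_le`): as
`cosh √u` is convex in `u`, adding an independent centred vector of norm at most `c` multiplies
`E cosh (l ‖S‖)` by at most `cosh (l c)`.

Given the sample, the entries of `H` are averages over independent neurons, and their means are
the entries of the kernel matrix. Hoeffding's inequality and a union bound over the `n (n + 1) / 2` entries on
and above the diagonal bound all deviations, hence the operator norm of the difference, by the first
square root except on an event of probability `(n + 1) δ / (2 n)`. The second square root is so
large that the deviation of the feature tensors exceeds it with probability at most
`2 (δ / 4) ^ 4`, and never for `n = 1`; so the total is at most `δ`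
(`jointLaw_eigenvalue_deviation_le`).

The eigenvalue sequence itself comes from the spectral theorem for compact positive operators, by
successive maximization (`isSpectralSequence_topValue`). Finally the smallest eigenvalue of `H` is
the one of index `n - 1`, which is close to `λ_{n-1}`, and `λ_i → 0`.
-/

/-! ### The Gaussian measure of the intersection of two half-spaces -/

theorem measurableSet_pos_and_pos {α : Type*} [MeasurableSpace α] {f g : α → ℝ}
    (hf : Measurable f) (hg : Measurable g) : MeasurableSet {a | 0 < f a ∧ 0 < g a} := by
  rw [Set.ofPred_and]
  exact (measurableSet_lt measurable_const hf).inter (measurableSet_lt measurable_const hg)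

theorem charFun_map_inner_pair_stdGaussian {E : Type*}
    [NormedAddCommGroup E] [InnerProductSpace ℝ E] [FiniteDimensional ℝ E]
    [MeasurableSpace E] [BorelSpace E] (x s : E) (t : EuclideanSpace ℝ (Fin 2)) :
    charFun ((stdGaussian E).map (fun w => (!₂[⟪w, x⟫, ⟪w, s⟫] : EuclideanSpace ℝ (Fin 2)))) t =
      Complex.exp (-((‖t 0 • x + t 1 • s‖ : ℝ) : ℂ) ^ 2 / 2) := by
  rw [← charFun_stdGaussian, charFun_apply, charFun_apply,
    integral_map (by fun_prop) (by fun_prop)]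
  congr 1 with w
  congr 3
  simp [PiLp.inner_apply, Fin.sum_univ_two, inner_add_right, inner_smul_right]

/-- Under the standard Gaussian measure, the joint law of two linear functionals depends only on
their Gram matrix. -/
theorem map_inner_pair_stdGaussian {E F : Type*}
    [NormedAddCommGroup E] [InnerProductSpace ℝ E] [FiniteDimensional ℝ E]
    [MeasurableSpace E] [BorelSpace E]
    [NormedAddCommGroup F] [InnerProductSpace ℝ F] [FiniteDimensional ℝ F]
    [MeasurableSpace F] [BorelSpace F] {x s : E} {x' s' : F}
    (hx : ‖x‖ = ‖x'‖) (hs : ‖s‖ = ‖s'‖) (hxs : ⟪x, s⟫ = ⟪x', s'⟫) :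
    (stdGaussian E).map (fun w => (!₂[⟪w, x⟫, ⟪w, s⟫] : EuclideanSpace ℝ (Fin 2))) =
      (stdGaussian F).map (fun w => (!₂[⟪w, x'⟫, ⟪w, s'⟫] : EuclideanSpace ℝ (Fin 2))) := by
  have hE : IsProbabilityMeasure ((stdGaussian E).map
      (fun w => (!₂[⟪w, x⟫, ⟪w, s⟫] : EuclideanSpace ℝ (Fin 2)))) :=
    Measure.isProbabilityMeasure_map (by fun_prop)
  have hF : IsProbabilityMeasure ((stdGaussian F).map
      (fun w => (!₂[⟪w, x'⟫, ⟪w, s'⟫] : EuclideanSpace ℝ (Fin 2)))) :=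
    Measure.isProbabilityMeasure_map (by fun_prop)
  refine Measure.ext_of_charFun ?_
  ext t
  rw [charFun_map_inner_pair_stdGaussian, charFun_map_inner_pair_stdGaussian]
  congr 3
  norm_cast
  rw [norm_add_sq_real, norm_add_sq_real]
  simp [norm_smul, inner_smul_left, inner_smul_right, hx, hs, hxs]

theorem lintegral_mul_exp_neg_half_sq :
    ∫⁻ r in Set.Ioi (0 : ℝ), ENNReal.ofReal (r * Real.exp (-r ^ 2 / 2)) = 1 := by
  have hd : ∀ r ∈ Set.Ici (0 : ℝ),
      HasDerivAt (fun r : ℝ => -Real.exp (-r ^ 2 / 2)) (r * Real.exp (-r ^ 2 / 2)) r := by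
    intro r _
    have h := (((hasDerivAt_pow 2 r).neg.div_const 2).exp).neg
    convert! h using 1
    simp; ring
  have hl : Tendsto (fun r : ℝ => -Real.exp (-r ^ 2 / 2)) atTop (𝓝 0) := by
    rw [← neg_zero]
    refine (Real.tendsto_exp_atBot.comp ?_).neg
    refine Tendsto.atBot_div_const (by norm_num) ?_
    exact tendsto_neg_atTop_atBot.comp (tendsto_pow_atTop (by norm_num))
  have hpos : ∀ r ∈ Set.Ioi (0 : ℝ), 0 ≤ r * Real.exp (-r ^ 2 / 2) := fun r hr =>
    mul_nonneg (le_of_lt hr) (Real.exp_nonneg _)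
  have hint := integrableOn_Ioi_deriv_of_nonneg' hd hpos hl
  have hval := integral_Ioi_of_hasDerivAt_of_nonneg' hd hpos hl
  rw [← ofReal_integral_eq_lintegral_ofReal hint
    ((ae_restrict_iff' measurableSet_Ioi).2 (Eventually.of_forall hpos)), hval]
  simp

/-- The angles in `(-π, π)` at distance less than `π / 2` both from `0` and from `θ` form an
interval. -/
theorem setOf_cos_pos_and_cos_sub_pos {θ : ℝ} (h0 : 0 ≤ θ) (hπ : θ ≤ Real.pi) :
    {φ ∈ Set.Ioo (-Real.pi) Real.pi | 0 < Real.cos φ ∧ 0 < Real.cos (φ - θ)} =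
      Set.Ioo (θ - Real.pi / 2) (Real.pi / 2) := by
  have hp := Real.pi_pos
  ext φ
  simp only [Set.mem_ofPred_eq, Set.mem_Ioo]
  constructor
  · rintro ⟨⟨h1, h2⟩, h3, h4⟩
    have h5 : φ < Real.pi / 2 := by
      by_contra! h
      exact absurd h3 (not_lt.2 (Real.cos_nonpos_of_pi_div_two_le_of_le h (by linarith)))
    refine ⟨?_, h5⟩
    have h6 : -(Real.pi / 2) < φ := by
      by_contra! h
      rw [← Real.cos_neg] at h3
      exact absurd h3
        (not_lt.2 (Real.cos_nonpos_of_pi_div_two_le_of_le (by linarith) (by linarith)))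
    by_contra! h
    rw [← Real.cos_neg] at h4
    exact absurd h4
      (not_lt.2 (Real.cos_nonpos_of_pi_div_two_le_of_le (by linarith) (by linarith)))
  · rintro ⟨h1, h2⟩
    exact ⟨⟨by linarith, by linarith⟩, Real.cos_pos_of_mem_Ioo ⟨by linarith, by linarith⟩,
      Real.cos_pos_of_mem_Ioo ⟨by linarith, by linarith⟩⟩

/-- The planar standard Gaussian measure of a sector with opening angle `π - θ`, computed in polar
coordinates. -/
theorem gaussian_prod_sector {θ : ℝ} (h0 : 0 ≤ θ) (hπ : θ ≤ Real.pi) :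
    ((gaussianReal 0 1).prod (gaussianReal 0 1))
      {p : ℝ × ℝ | 0 < p.1 ∧ 0 < Real.cos θ * p.1 + Real.sin θ * p.2} =
      ENNReal.ofReal ((Real.pi - θ) / (2 * Real.pi)) := by
  have hp := Real.pi_pos
  have hS : MeasurableSet {p : ℝ × ℝ | 0 < p.1 ∧ 0 < Real.cos θ * p.1 + Real.sin θ * p.2} :=
    measurableSet_pos_and_pos (by fun_prop) (by fun_prop)
  set A : Set ℝ := {φ ∈ Set.Ioo (-Real.pi) Real.pi | 0 < Real.cos φ ∧ 0 < Real.cos (φ - θ)}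
    with hA
  have hAm : MeasurableSet A := by
    rw [hA, setOf_cos_pos_and_cos_sub_pos h0 hπ]; exact measurableSet_Ioo
  rw [gaussianReal_of_var_ne_zero 0 one_ne_zero,
    prod_withDensity (measurable_gaussianPDF _ _) (measurable_gaussianPDF _ _),
    withDensity_apply _ hS, ← lintegral_indicator hS, ← Measure.volume_eq_prod,
    ← lintegral_comp_polarCoord_symm]
  have hpt : ∀ p ∈ polarCoord.target, ENNReal.ofReal p.1 •
      ({p : ℝ × ℝ | 0 < p.1 ∧ 0 < Real.cos θ * p.1 + Real.sin θ * p.2}.indicator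
        (fun z => gaussianPDF 0 1 z.1 * gaussianPDF 0 1 z.2) (polarCoord.symm p)) =
      ENNReal.ofReal (p.1 * Real.exp (-p.1 ^ 2 / 2)) *
        A.indicator (fun _ => ENNReal.ofReal (1 / (2 * Real.pi))) p.2 := by
    rintro ⟨r, φ⟩ ⟨hr, hφ⟩
    have hr : 0 < r := hr
    have hmem : ((r * Real.cos φ, r * Real.sin φ) ∈
        {p : ℝ × ℝ | 0 < p.1 ∧ 0 < Real.cos θ * p.1 + Real.sin θ * p.2}) ↔ φ ∈ A := by
      have e : Real.cos θ * (r * Real.cos φ) + Real.sin θ * (r * Real.sin φ) =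
          r * Real.cos (φ - θ) := by rw [Real.cos_sub]; ring
      simp only [hA, Set.mem_ofPred_eq, e, mul_pos_iff_of_pos_left hr]
      exact ⟨fun h => ⟨hφ, h⟩, fun h => h.2⟩
    simp only [polarCoord_symm_apply, smul_eq_mul]
    by_cases h : φ ∈ A
    · rw [Set.indicator_of_mem (hmem.2 h), Set.indicator_of_mem h]
      simp only [gaussianPDF, gaussianPDFReal]
      rw [← ENNReal.ofReal_mul (by positivity), ← ENNReal.ofReal_mul (by positivity),
        ← ENNReal.ofReal_mul (by positivity)]
      congr 1
      have e1 : Real.exp (-(r * Real.cos φ) ^ 2 / 2) * Real.exp (-(r * Real.sin φ) ^ 2 / 2) =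
          Real.exp (-r ^ 2 / 2) := by
        rw [← Real.exp_add]
        congr 1
        linear_combination (-r ^ 2 / 2) * Real.sin_sq_add_cos_sq φ
      have e2 : (√(2 * Real.pi))⁻¹ * (√(2 * Real.pi))⁻¹ = 1 / (2 * Real.pi) := by
        rw [← mul_inv, Real.mul_self_sqrt (by positivity), one_div]
      simp only [NNReal.coe_one, mul_one, sub_zero]
      rw [← e1, ← e2]
      ring
    · rw [Set.indicator_of_notMem (fun h' => h (hmem.1 h')), Set.indicator_of_notMem h]
      simp
  have htgt : polarCoord.target = Set.Ioi (0 : ℝ) ×ˢ Set.Ioo (-Real.pi) Real.pi := rfl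
  rw [setLIntegral_congr_fun polarCoord.open_target.measurableSet hpt, htgt,
    Measure.volume_eq_prod, ← Measure.prod_restrict,
    lintegral_prod_mul (f := fun r : ℝ => ENNReal.ofReal (r * Real.exp (-r ^ 2 / 2)))
      (by fun_prop) (measurable_const.indicator hAm).aemeasurable,
    lintegral_mul_exp_neg_half_sq, one_mul,
    lintegral_indicator hAm, setLIntegral_const, Measure.restrict_apply hAm,
    Set.inter_eq_left.2 (fun φ hφ => hφ.1), hA, setOf_cos_pos_and_cos_sub_pos h0 hπ,
    Real.volume_Ioo, ← ENNReal.ofReal_mul (by positivity)]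
  congr 1
  field_simp
  ring

theorem measurableSet_halfSpace_inter {d : ℕ} (x s : Feat d) :
    MeasurableSet {w : Feat d | 0 < ⟪w, x⟫ ∧ 0 < ⟪w, s⟫} :=
  measurableSet_pos_and_pos (by fun_prop) (by fun_prop)

/-- **Sheppard's formula**: two half-spaces with unit normals at angle `θ` meet in a set of
standard Gaussian measure `(π - θ) / (2π)`. -/
theorem stdGaussian_halfSpace_inter {d : ℕ} (x s : Sph d) :
    stdGaussian (Feat d) {w | 0 < ⟪w, (x : Feat d)⟫ ∧ 0 < ⟪w, (s : Feat d)⟫} =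
      ENNReal.ofReal
        ((Real.pi - Real.arccos ⟪(x : Feat d), (s : Feat d)⟫) / (2 * Real.pi)) := by
  have hx : ‖(x : Feat d)‖ = 1 := by simp
  have hs : ‖(s : Feat d)‖ = 1 := by simp
  have h1 : |⟪(x : Feat d), (s : Feat d)⟫| ≤ 1 := by
    simpa [hx, hs] using abs_real_inner_le_norm (x : Feat d) (s : Feat d)
  set θ := Real.arccos ⟪(x : Feat d), (s : Feat d)⟫ with hθ
  have hcos : Real.cos θ = ⟪(x : Feat d), (s : Feat d)⟫ :=
    Real.cos_arccos (abs_le.1 h1).1 (abs_le.1 h1).2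
  have hsin := Real.sin_sq_add_cos_sq θ
  -- A planar pair of vectors with the same Gram matrix as `x`, `s`; unlike an orthonormal basis of
  -- the span of `x` and `s`, it also serves the degenerate case `s = ± x`.
  let x' : EuclideanSpace ℝ (Fin 2) := !₂[1, 0]
  let s' : EuclideanSpace ℝ (Fin 2) := !₂[Real.cos θ, Real.sin θ]
  have hmap := map_inner_pair_stdGaussian (x := (x : Feat d)) (s := (s : Feat d)) (x' := x')
    (s' := s') (by simp [x', EuclideanSpace.norm_eq])
    (by
      rw [hs, EuclideanSpace.norm_eq]
      simp [s'])
    (by simp [x', s', PiLp.inner_apply, Fin.sum_univ_two, hcos])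
  let Q : Set (EuclideanSpace ℝ (Fin 2)) := {u | 0 < u 0 ∧ 0 < u 1}
  have hQ : MeasurableSet Q := measurableSet_pos_and_pos (by fun_prop) (by fun_prop)
  have h2 := congrArg (fun μ => μ Q) hmap
  simp only at h2
  rw [Measure.map_apply (by fun_prop) hQ, Measure.map_apply (by fun_prop) hQ,
    ← map_pi_eq_stdGaussian (ι := Fin 2), Measure.map_apply (by fun_prop)
      (hQ.preimage (by fun_prop))] at h2
  rw [← gaussian_prod_sector (Real.arccos_nonneg _) (Real.arccos_le_pi _)]
  refine Eq.trans h2 ?_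
  rw [← (measurePreserving_finTwoArrow (gaussianReal 0 1)).measure_preimage
    (measurableSet_pos_and_pos (by fun_prop) (by fun_prop)).nullMeasurableSet]
  congr 1
  ext u
  simp [Q, x', s', PiLp.inner_apply, Fin.sum_univ_two, hθ]

theorem multivariateGaussian_sq_smul_one (d : ℕ) (ν : ℝ) :
    multivariateGaussian (0 : Feat d) (ν ^ 2 • (1 : Matrix (Fin d) (Fin d) ℝ)) =
      (stdGaussian (Feat d)).map (fun w => ν • w) := by
  have : IsProbabilityMeasure ((stdGaussian (Feat d)).map (fun w => ν • w)) :=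
    Measure.isProbabilityMeasure_map (by fun_prop)
  have hS : (ν ^ 2 • (1 : Matrix (Fin d) (Fin d) ℝ)).PosSemidef :=
    Matrix.PosSemidef.one.smul (sq_nonneg ν)
  refine Measure.ext_of_charFun ?_
  ext t
  rw [charFun_multivariateGaussian hS, charFun_map_smul, charFun_stdGaussian]
  congr 1
  rw [norm_smul, Matrix.smul_mulVec, Matrix.one_mulVec, dotProduct_smul]
  have : t.ofLp ⬝ᵥ t.ofLp = ‖t‖ ^ 2 := by
    rw [EuclideanSpace.real_norm_sq_eq]; simp [dotProduct, sq]
  have h2 : ‖ν‖ ^ 2 = ν ^ 2 := by simp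
  rw [this, smul_eq_mul, ← h2, inner_zero_right]
  push_cast
  ring

/-- The intersection of two centred half-spaces is a cone, so its measure does not depend on the
variance of the isotropic Gaussian. -/
theorem gaussian_halfSpace_inter {d : ℕ} {ν : ℝ} (hν : 0 < ν) (x s : Sph d) :
    multivariateGaussian (0 : Feat d) (ν ^ 2 • (1 : Matrix (Fin d) (Fin d) ℝ))
        {w | 0 < ⟪w, (x : Feat d)⟫ ∧ 0 < ⟪w, (s : Feat d)⟫} =
      ENNReal.ofReal
        ((Real.pi - Real.arccos ⟪(x : Feat d), (s : Feat d)⟫) / (2 * Real.pi)) := by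
  rw [multivariateGaussian_sq_smul_one,
    Measure.map_apply (by fun_prop) (measurableSet_halfSpace_inter _ _),
    ← stdGaussian_halfSpace_inter]
  congr 1
  ext w
  simp [inner_smul_left, hν]

/-! ### Concentration of sums of independent vectors in a Hilbert space -/

/-- `u ↦ cosh √u` is a power series in `u` with non-negative coefficients, hence convex on
`[0, ∞)`. -/
theorem cosh_le_of_sq_eq {p q y a b : ℝ} (hp : 0 ≤ p) (hq : 0 ≤ q) (hpq : p + q = 1)
    (h : y ^ 2 = p * a ^ 2 + q * b ^ 2) :
    Real.cosh y ≤ p * Real.cosh a + q * Real.cosh b := by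
  refine hasSum_le (fun k => ?_) (Real.hasSum_cosh y)
    (((Real.hasSum_cosh a).mul_left p).add ((Real.hasSum_cosh b).mul_left q))
  have hk := (convexOn_pow k).2 (Set.mem_Ici.2 (sq_nonneg a)) (Set.mem_Ici.2 (sq_nonneg b)) hp hq
    hpq
  simp only [smul_eq_mul] at hk
  rw [pow_mul, pow_mul, pow_mul, h, ← mul_div_assoc, ← mul_div_assoc, ← add_div]
  gcongr

/-- A bound on `cosh (l ‖s + v‖)` for `‖v‖ ≤ c` which is affine in `⟪s, v⟫`, with equality for
`v = ± c s / ‖s‖`. Averaged over a centred `v`, it gives `cosh (l ‖s‖) * cosh (l c)`. -/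
theorem cosh_norm_add_le {G : Type*} [NormedAddCommGroup G] [InnerProductSpace ℝ G]
    {c : ℝ} (hc : 0 < c) (l : ℝ) {s v : G} (hv : ‖v‖ ≤ c) :
    Real.cosh (l * ‖s + v‖) ≤ Real.cosh (l * ‖s‖) * Real.cosh (l * c) +
      ⟪s, v⟫ / (‖s‖ * c) * (Real.sinh (l * ‖s‖) * Real.sinh (l * c)) := by
  set τ : ℝ := ⟪s, v⟫ / (‖s‖ * c) with hτ
  have hsv := abs_real_inner_le_norm s v
  have hτ1 : |τ| ≤ 1 := by
    rw [hτ, abs_div, abs_of_nonneg (by positivity : 0 ≤ ‖s‖ * c)]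
    refine div_le_one_of_le₀ (hsv.trans ?_) (by positivity)
    gcongr
  have hinner : ⟪s, v⟫ = ‖s‖ * c * τ := by
    rcases eq_or_ne s 0 with rfl | hs
    · simp
    · rw [hτ]
      have : ‖s‖ ≠ 0 := norm_ne_zero_iff.2 hs
      field_simp
  have hnorm : ‖s + v‖ ^ 2 ≤ (1 + τ) / 2 * (‖s‖ + c) ^ 2 + (1 - τ) / 2 * (‖s‖ - c) ^ 2 := by
    rw [norm_add_sq_real, hinner]
    have : ‖v‖ ^ 2 ≤ c ^ 2 := by gcongr
    linarith
  obtain ⟨h1, h2⟩ := abs_le.1 hτ1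
  have hnn : 0 ≤ (1 + τ) / 2 * (‖s‖ + c) ^ 2 + (1 - τ) / 2 * (‖s‖ - c) ^ 2 :=
    (sq_nonneg _).trans hnorm
  set y := √((1 + τ) / 2 * (‖s‖ + c) ^ 2 + (1 - τ) / 2 * (‖s‖ - c) ^ 2) with hy
  have hle : Real.cosh (l * ‖s + v‖) ≤ Real.cosh (l * y) := by
    rw [Real.cosh_le_cosh, abs_mul, abs_mul, abs_of_nonneg (norm_nonneg _),
      abs_of_nonneg (Real.sqrt_nonneg _)]
    gcongr
    exact Real.le_sqrt_of_sq_le hnorm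
  refine hle.trans ((cosh_le_of_sq_eq (p := (1 + τ) / 2) (q := (1 - τ) / 2) (a := l * (‖s‖ + c))
    (b := l * (‖s‖ - c)) (by linarith) (by linarith) (by ring) ?_).trans_eq ?_)
  · rw [mul_pow, hy, Real.sq_sqrt hnn]
    ring
  · rw [mul_add, mul_sub, Real.cosh_add, Real.cosh_sub]
    ring

section Concentration

variable {Ω G : Type*} [MeasurableSpace Ω] {P : Measure Ω} [IsProbabilityMeasure P]
  [NormedAddCommGroup G] [InnerProductSpace ℝ G] [CompleteSpace G] {X : Ω → G} {c : ℝ}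

theorem lintegral_cosh_norm_add_le (hX : StronglyMeasurable X) (hc : 0 < c) (hb : ∀ ω, ‖X ω‖ ≤ c)
    (h0 : ∫ ω, X ω ∂P = 0) (l : ℝ) (s : G) :
    ∫⁻ ω, ENNReal.ofReal (Real.cosh (l * ‖s + X ω‖)) ∂P ≤
      ENNReal.ofReal (Real.cosh (l * ‖s‖)) * ENNReal.ofReal (Real.cosh (l * c)) := by
  have hXi : Integrable X P := .of_bound hX.aestronglyMeasurable c (Eventually.of_forall hb)
  have hi : Integrable (fun ω => ⟪s, X ω⟫) P := hXi.const_inner s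
  have hi2 : Integrable (fun ω => Real.cosh (l * ‖s‖) * Real.cosh (l * c) +
      ⟪s, X ω⟫ / (‖s‖ * c) * (Real.sinh (l * ‖s‖) * Real.sinh (l * c))) P :=
    (integrable_const _).add ((hi.div_const _).mul_const _)
  have hpt := fun ω => cosh_norm_add_le hc l (s := s) (hb ω)
  calc ∫⁻ ω, ENNReal.ofReal (Real.cosh (l * ‖s + X ω‖)) ∂P
      ≤ ∫⁻ ω, ENNReal.ofReal (Real.cosh (l * ‖s‖) * Real.cosh (l * c) +
          ⟪s, X ω⟫ / (‖s‖ * c) * (Real.sinh (l * ‖s‖) * Real.sinh (l * c))) ∂P :=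
        lintegral_mono fun ω => ENNReal.ofReal_le_ofReal (hpt ω)
    _ = ENNReal.ofReal (Real.cosh (l * ‖s‖) * Real.cosh (l * c)) := by
        rw [← ofReal_integral_eq_lintegral_ofReal hi2
          (Eventually.of_forall fun ω => (Real.cosh_pos _).le.trans (hpt ω))]
        congr 1
        rw [integral_add (integrable_const _) ((hi.div_const _).mul_const _),
          integral_mul_const (Real.sinh (l * ‖s‖) * Real.sinh (l * c)), integral_div,
          integral_inner hXi, h0]
        simp
    _ = _ := ENNReal.ofReal_mul (Real.cosh_pos _).le

theorem lintegral_cosh_norm_sum_le (hX : StronglyMeasurable X) (hc : 0 < c) (hb : ∀ ω, ‖X ω‖ ≤ c)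
    (h0 : ∫ ω, X ω ∂P = 0) (l : ℝ) (n : ℕ) : ∀ s : G,
    ∫⁻ x, ENNReal.ofReal (Real.cosh (l * ‖s + ∑ i, X (x i)‖)) ∂(Measure.pi fun _ : Fin n => P) ≤
      ENNReal.ofReal (Real.cosh (l * ‖s‖)) * ENNReal.ofReal (Real.cosh (l * c)) ^ n := by
  induction n with
  | zero => intro s; simp
  | succ n ih =>
    intro s
    have hmp := (measurePreserving_piFinSuccAbove (fun _ : Fin (n + 1) => P) 0).symm
    have hmeas : ∀ (k : ℕ) (s : G), Measurable fun x : Fin k → Ω =>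
        ENNReal.ofReal (Real.cosh (l * ‖s + ∑ i, X (x i)‖)) := by
      intro k s
      have : StronglyMeasurable fun x : Fin k → Ω => s + ∑ i, X (x i) :=
        stronglyMeasurable_const.add (Finset.stronglyMeasurable_fun_sum _ fun i _ =>
          hX.comp_measurable (measurable_pi_apply i))
      have h2 := this.norm.measurable
      fun_prop
    rw [← hmp.lintegral_comp (hmeas _ s)]
    have hcomp : ∀ p : Ω × (Fin n → Ω),
        (∑ i, X ((MeasurableEquiv.piFinSuccAbove (fun _ : Fin (n + 1) => Ω) 0).symm p i)) =
          X p.1 + ∑ i, X (p.2 i) := by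
      intro p
      rw [Fin.sum_univ_succ]
      simp [MeasurableEquiv.piFinSuccAbove]
    refine (lintegral_prod _ ((hmeas _ s).comp hmp.measurable).aemeasurable).trans_le ?_
    simp only [Function.comp_apply, hcomp]
    calc ∫⁻ y, ∫⁻ x, ENNReal.ofReal (Real.cosh (l * ‖s + (X y + ∑ i, X (x i))‖))
            ∂(Measure.pi fun _ : Fin n => P) ∂P
        ≤ ∫⁻ y, ENNReal.ofReal (Real.cosh (l * ‖s + X y‖)) *
            ENNReal.ofReal (Real.cosh (l * c)) ^ n ∂P := by
          refine lintegral_mono fun y => ?_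
          simp only [← add_assoc]
          exact ih (s + X y)
      _ = (∫⁻ y, ENNReal.ofReal (Real.cosh (l * ‖s + X y‖)) ∂P) *
            ENNReal.ofReal (Real.cosh (l * c)) ^ n :=
          lintegral_mul_const' _ _ (by finiteness)
      _ ≤ ENNReal.ofReal (Real.cosh (l * ‖s‖)) * ENNReal.ofReal (Real.cosh (l * c)) *
            ENNReal.ofReal (Real.cosh (l * c)) ^ n := by
          gcongr
          exact lintegral_cosh_norm_add_le hX hc hb h0 l s
      _ = _ := by rw [pow_succ']; ring

/-- **Hoeffding's inequality in Hilbert space**, with the dimension-free constant of Pinelis: the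
sum of `n` independent centred vectors of norm at most `c` has norm at least `n t` with probability
at most `2 exp (-n t² / (2 c²))`. -/
theorem measure_norm_sum_ge_le (hX : StronglyMeasurable X) (hc : 0 < c) (hb : ∀ ω, ‖X ω‖ ≤ c)
    (h0 : ∫ ω, X ω ∂P = 0) (n : ℕ) {t : ℝ} (ht : 0 ≤ t) :
    (Measure.pi fun _ : Fin n => P) {x | n * t ≤ ‖∑ i, X (x i)‖} ≤
      ENNReal.ofReal (2 * Real.exp (-n * t ^ 2 / (2 * c ^ 2))) := by
  -- The value of the exponent that minimizes the bound.
  set l : ℝ := t / c ^ 2 with hl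
  have hl0 : 0 ≤ l := by positivity
  have hmom := lintegral_cosh_norm_sum_le (P := P) hX hc hb h0 l n 0
  simp only [zero_add, norm_zero, mul_zero, Real.cosh_zero, ENNReal.ofReal_one, one_mul] at hmom
  have hsum : StronglyMeasurable fun x : Fin n → Ω => ∑ i, X (x i) :=
    Finset.stronglyMeasurable_fun_sum _ fun i _ => hX.comp_measurable (measurable_pi_apply i)
  have hmeas : Measurable fun x : Fin n → Ω =>
      ENNReal.ofReal (Real.cosh (l * ‖∑ i, X (x i)‖)) := by
    have := hsum.norm.measurable
    fun_prop
  have hE : 0 < Real.exp (l * (n * t)) / 2 := by positivity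
  have hsub : {x : Fin n → Ω | n * t ≤ ‖∑ i, X (x i)‖} ⊆
      {x | ENNReal.ofReal (Real.exp (l * (n * t)) / 2) ≤
        ENNReal.ofReal (Real.cosh (l * ‖∑ i, X (x i)‖))} := by
    intro x hx
    refine ENNReal.ofReal_le_ofReal ?_
    rw [Real.cosh_eq]
    have h1 : Real.exp (l * (n * t)) ≤ Real.exp (l * ‖∑ i, X (x i)‖) :=
      Real.exp_le_exp.2 (mul_le_mul_of_nonneg_left hx hl0)
    have h2 := Real.exp_pos (-(l * ‖∑ i, X (x i)‖))
    linarith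
  refine (measure_mono hsub).trans ?_
  refine (meas_ge_le_lintegral_div hmeas.aemeasurable (by simpa using hE) (by finiteness)).trans ?_
  refine ENNReal.div_le_of_le_mul (hmom.trans ?_)
  rw [← ENNReal.ofReal_mul (by positivity), ← ENNReal.ofReal_pow (Real.cosh_pos _).le]
  refine ENNReal.ofReal_le_ofReal ?_
  calc Real.cosh (l * c) ^ n ≤ Real.exp ((l * c) ^ 2 / 2) ^ n := by
        gcongr
        exact Real.cosh_le_exp_half_sq _
    _ = Real.exp (-n * t ^ 2 / (2 * c ^ 2)) * Real.exp (l * (n * t)) := by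
        rw [← Real.exp_nat_mul, ← Real.exp_add]
        congr 1
        rw [hl]
        field_simp
        ring
    _ = _ := by ring

end Concentration

/-! ### The min-max principle for quadratic forms -/

section MinMax

variable {E : Type*} [NormedAddCommGroup E] [InnerProductSpace ℝ E]

/-- The form `q` is at most `c ‖x‖²` on the orthogonal complement of a subspace of dimension at
most `k`. For the form of a compact positive operator this says that the `k`-th eigenvalue, counted
from `0`, is at most `c`. -/
def UpperForm (q : E → ℝ) (k : ℕ) (c : ℝ) : Prop :=
  ∃ V : Submodule ℝ E, FiniteDimensional ℝ V ∧ Module.finrank ℝ V ≤ k ∧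
    ∀ x ∈ Vᗮ, q x ≤ c * ‖x‖ ^ 2

/-- The form `q` is at least `c ‖x‖²` on a subspace of finite dimension greater than `k`. For the
form of a compact positive operator and `c > 0` this says that the `k`-th eigenvalue, counted from
`0`, is at least `c`. -/
def LowerForm (q : E → ℝ) (k : ℕ) (c : ℝ) : Prop :=
  ∃ W : Submodule ℝ E, FiniteDimensional ℝ W ∧ k < Module.finrank ℝ W ∧
    ∀ x ∈ W, c * ‖x‖ ^ 2 ≤ q x

/-- **Weyl's perturbation inequality**: a subspace of dimension greater than `k` meets the
orthogonal complement of a subspace of dimension at most `k`. -/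
theorem LowerForm.le_add {q q' : E → ℝ} {k : ℕ} {a b ε : ℝ} (hl : LowerForm q k a)
    (hu : UpperForm q' k b) (h : ∀ x, q x ≤ q' x + ε * ‖x‖ ^ 2) : a ≤ b + ε := by
  obtain ⟨W, hWf, hW, hWq⟩ := hl
  obtain ⟨V, hVf, hV, hVq⟩ := hu
  have hlt : Module.finrank ℝ V < Module.finrank ℝ W := hV.trans_lt hW
  let f : W →ₗ[ℝ] V := (V.orthogonalProjectionOnto : E →ₗ[ℝ] V).comp W.subtype
  obtain ⟨⟨x, hxW⟩, hxf, hx0⟩ := Submodule.exists_mem_ne_zero_of_ne_bot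
    (LinearMap.ker_ne_bot_of_finrank_lt (f := f) hlt)
  have hxV : x ∈ Vᗮ := Submodule.orthogonalProjectionOnto_eq_zero_iff.1 hxf
  have hx : 0 < ‖x‖ ^ 2 := by
    have : x ≠ 0 := fun h => hx0 (Subtype.ext h)
    positivity
  have h1 := hWq x hxW
  have h2 := hVq x hxV
  have h3 := h x
  refine le_of_mul_le_mul_right ?_ hx
  linarith

section Adjoint

variable [CompleteSpace E] {G : Type*} [NormedAddCommGroup G] [InnerProductSpace ℝ G]
  [CompleteSpace G]

theorem norm_apply_sq_le_norm_adjoint_apply (A : E →L[ℝ] G) (h : E) :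
    ‖A h‖ ^ 2 ≤ ‖A.adjoint (A h)‖ * ‖h‖ := by
  rw [← real_inner_self_eq_norm_sq, ← ContinuousLinearMap.adjoint_inner_left]
  exact real_inner_le_norm _ _

/-- The nonzero eigenvalues of `A A†` bound those of `A† A` from above. -/
theorem UpperForm.of_adjoint {A : E →L[ℝ] G} {k : ℕ} {c : ℝ} (hc : 0 ≤ c)
    (h : UpperForm (fun u => ‖A.adjoint u‖ ^ 2) k c) : UpperForm (fun x => ‖A x‖ ^ 2) k c := by
  obtain ⟨V, hVf, hV, hVq⟩ := h
  refine ⟨V.map (A.adjoint : G →ₗ[ℝ] E), inferInstance,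
    (Submodule.finrank_map_le _ _).trans hV, fun x hx => ?_⟩
  have hAx : A x ∈ Vᗮ := by
    rw [Submodule.mem_orthogonal'] at hx ⊢
    intro v hv
    rw [← ContinuousLinearMap.adjoint_inner_right]
    exact hx _ (Submodule.mem_map_of_mem hv)
  have h1 := hVq _ hAx
  have h2 := norm_apply_sq_le_norm_adjoint_apply A x
  simp only at h1 ⊢
  rcases (norm_nonneg (A x)).eq_or_lt with h0 | h0
  · rw [← h0, zero_pow two_ne_zero]; exact mul_nonneg hc (sq_nonneg _)
  · have h3 : (‖A x‖ ^ 2) ^ 2 ≤ (‖A.adjoint (A x)‖ * ‖x‖) ^ 2 := by gcongr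
    rw [mul_pow] at h3
    have h4 := mul_le_mul_of_nonneg_right h1 (sq_nonneg ‖x‖)
    refine le_of_mul_le_mul_right ?_ (pow_pos h0 2)
    linarith

/-- The nonzero eigenvalues of `A A†` bound those of `A† A` from below. -/
theorem LowerForm.of_adjoint {A : E →L[ℝ] G} {k : ℕ} {c : ℝ} (hc : 0 < c)
    (h : LowerForm (fun u => ‖A.adjoint u‖ ^ 2) k c) : LowerForm (fun x => ‖A x‖ ^ 2) k c := by
  obtain ⟨W, hWf, hW, hWq⟩ := h
  have hinj : Function.Injective ((A.adjoint : G →ₗ[ℝ] E).domRestrict W) := by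
    refine (injective_iff_map_eq_zero _).2 fun u hu => ?_
    have h1 := hWq u u.2
    have h2 : A.adjoint (u : G) = 0 := hu
    simp only [h2, norm_zero] at h1
    have h3 : ‖(u : G)‖ ^ 2 = 0 := by nlinarith [sq_nonneg ‖(u : G)‖]
    simpa using h3
  refine ⟨W.map (A.adjoint : G →ₗ[ℝ] E), inferInstance, ?_, ?_⟩
  · rwa [← LinearMap.range_domRestrict, LinearMap.finrank_range_of_inj hinj]
  · rintro _ ⟨u, hu, rfl⟩
    have h1 := hWq u hu
    have h2 := norm_apply_sq_le_norm_adjoint_apply A.adjoint u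
    rw [ContinuousLinearMap.adjoint_adjoint] at h2
    simp only [ContinuousLinearMap.coe_coe] at h1 ⊢
    rcases (norm_nonneg (A.adjoint u)).eq_or_lt with h0 | h0
    · rw [← h0, zero_pow two_ne_zero, mul_zero]; exact sq_nonneg _
    · have h3 : (‖A.adjoint u‖ ^ 2) ^ 2 ≤ (‖A (A.adjoint u)‖ * ‖u‖) ^ 2 := by gcongr
      rw [mul_pow] at h3
      have h4 := mul_le_mul_of_nonneg_left h1 (sq_nonneg ‖A (A.adjoint u)‖)
      refine le_of_mul_le_mul_right ?_ (pow_pos h0 2)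
      have h5 := mul_le_mul_of_nonneg_left h3 hc.le
      linarith

end Adjoint

theorem Orthonormal.inner_map_sum_eq {ι : Type*} [Fintype ι] {e : ι → E} (he : Orthonormal ℝ e)
    {T : E →ₗ[ℝ] E} {c : ι → ℝ} (hT : ∀ i, T (e i) = c i • e i) (a : ι → ℝ) :
    ⟪T (∑ i, a i • e i), ∑ i, a i • e i⟫ = ∑ i, c i * a i ^ 2 := by
  simp only [map_sum, map_smul, hT, smul_smul]
  rw [he.inner_sum]
  exact Finset.sum_congr rfl fun i _ => by simp; ring

theorem LowerForm.of_orthonormal {k : ℕ} {e : Fin (k + 1) → E} (he : Orthonormal ℝ e)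
    {T : E →ₗ[ℝ] E} {c : Fin (k + 1) → ℝ} (hT : ∀ i, T (e i) = c i • e i) {a : ℝ}
    (ha : ∀ i, a ≤ c i) : LowerForm (fun x => ⟪T x, x⟫) k a := by
  refine ⟨Submodule.span ℝ (Set.range e),
    FiniteDimensional.span_of_finite ℝ (Set.finite_range e), ?_, fun x hx => ?_⟩
  · rw [finrank_span_eq_card he.linearIndependent]
    simp
  · obtain ⟨b, rfl⟩ := (Submodule.mem_span_range_iff_exists_fun ℝ).1 hx
    have h1 := he.inner_map_sum_eq (T := LinearMap.id) (c := fun _ => 1) (fun i => by simp) b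
    rw [LinearMap.id_apply, real_inner_self_eq_norm_sq] at h1
    simp only [he.inner_map_sum_eq hT, h1, Finset.mul_sum, one_mul]
    gcongr with i
    exact ha i

theorem LinearMap.IsSymmetric.lowerForm_eigenvalues [FiniteDimensional ℝ E] {T : E →ₗ[ℝ] E}
    (hT : T.IsSymmetric) {n : ℕ} (hn : Module.finrank ℝ E = n) (k : Fin n) :
    LowerForm (fun x => ⟪T x, x⟫) k (hT.eigenvalues hn k) := by
  refine LowerForm.of_orthonormal (e := fun i : Fin (k + 1) =>
    hT.eigenvectorBasis hn (Fin.castLE k.2 i)) ?_ (fun i => hT.apply_eigenvectorBasis hn _) ?_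
  · exact (hT.eigenvectorBasis hn).orthonormal.comp _ (Fin.castLE_injective _)
  · intro i
    refine hT.eigenvalues_antitone hn ?_
    rw [Fin.le_def, Fin.val_castLE]
    exact Nat.lt_succ_iff.1 i.2

theorem LinearMap.IsSymmetric.upperForm_eigenvalues [FiniteDimensional ℝ E] {T : E →ₗ[ℝ] E}
    (hT : T.IsSymmetric) {n : ℕ} (hn : Module.finrank ℝ E = n) (k : Fin n) :
    UpperForm (fun x => ⟪T x, x⟫) k (hT.eigenvalues hn k) := by
  set b := hT.eigenvectorBasis hn with hb
  refine ⟨Submodule.span ℝ (Set.range fun i : Fin k => b (Fin.castLE k.2.le i)),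
    FiniteDimensional.span_of_finite ℝ (Set.finite_range _), ?_, fun x hx => ?_⟩
  · exact (finrank_range_le_card _).trans (by simp)
  · have h1 := b.orthonormal.inner_map_sum_eq (T := LinearMap.id) (c := fun _ => 1)
      (fun i => by simp) (fun i => ⟪b i, x⟫)
    have h2 := b.orthonormal.inner_map_sum_eq (fun i => hT.apply_eigenvectorBasis hn i)
      (fun i => ⟪b i, x⟫)
    simp only [b.sum_repr', LinearMap.id_apply, real_inner_self_eq_norm_sq, one_mul] at h1 h2
    simp only [h1, h2, Finset.mul_sum]
    refine Finset.sum_le_sum fun i _ => ?_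
    rcases lt_or_ge i k with hik | hik
    · have : ⟪b i, x⟫ = 0 := by
        refine (Submodule.mem_orthogonal _ _).1 hx _ (Submodule.subset_span ⟨⟨i, hik⟩, ?_⟩)
        simp
      simp [this]
    · gcongr
      exact hT.eigenvalues_antitone hn hik

end MinMax

/-! ### The spectral sequence of a compact positive operator -/

section SpectralSequence

variable {E : Type*} [NormedAddCommGroup E] [InnerProductSpace ℝ E] [CompleteSpace E]
  (T : E →L[ℝ] E)

/-- The norm of `T` on the orthogonal complement of `V`. -/
noncomputable def normOnCompl (V : Submodule ℝ E) : ℝ := ‖T ∘L Vᗮ.starProjection‖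

open Classical in
/-- A unit vector of the orthogonal complement of `V` which is an eigenvector of `T` for the
eigenvalue `normOnCompl T V`, and `0` if there is none. -/
noncomputable def topVector (V : Submodule ℝ E) : E :=
  if h : ∃ e : E, ‖e‖ = 1 ∧ e ∈ Vᗮ ∧ T e = normOnCompl T V • e then h.choose else 0

/-- The span of the first `k` eigenvectors of `T` found by successive maximization. -/
noncomputable def topSpace : ℕ → Submodule ℝ E
  | 0 => ⊥
  | k + 1 => topSpace k ⊔ Submodule.span ℝ {topVector T (topSpace k)}

/-- The `k`-th eigenvalue of `T`, counted from `0`, found by successive maximization. -/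
noncomputable def topValue (k : ℕ) : ℝ := normOnCompl T (topSpace T k)

variable {T}

theorem topValue_nonneg (k : ℕ) : 0 ≤ topValue T k := norm_nonneg _

theorem apply_le_normOnCompl {V : Submodule ℝ E} {x : E} (hx : x ∈ Vᗮ) :
    ‖T x‖ ≤ normOnCompl T V * ‖x‖ := by
  have h := (T ∘L Vᗮ.starProjection).le_opNorm x
  rwa [ContinuousLinearMap.comp_apply, Submodule.starProjection_eq_self_iff.2 hx] at h

theorem normOnCompl_antitone : Antitone (normOnCompl T) := by
  intro V W hVW
  refine ContinuousLinearMap.opNorm_le_bound _ (norm_nonneg _) fun x => ?_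
  rw [ContinuousLinearMap.comp_apply]
  refine (apply_le_normOnCompl
    (Submodule.orthogonal_le hVW (Submodule.starProjection_apply_mem _ x))).trans ?_
  gcongr
  · exact norm_nonneg _
  · exact Submodule.norm_starProjection_apply_le _ _

theorem topSpace_monotone : Monotone (topSpace T) :=
  monotone_nat_of_le_succ fun _ => le_sup_left

theorem topValue_antitone : Antitone (topValue T) := fun _ _ h =>
  normOnCompl_antitone (topSpace_monotone h)

theorem finiteDimensional_topSpace (k : ℕ) : FiniteDimensional ℝ (topSpace T k) := by
  induction k with
  | zero => exact inferInstanceAs (FiniteDimensional ℝ (⊥ : Submodule ℝ E))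
  | succ k ih =>
    exact inferInstanceAs (FiniteDimensional ℝ
      (topSpace T k ⊔ Submodule.span ℝ {topVector T (topSpace T k)} : Submodule ℝ E))

theorem finrank_topSpace_le (k : ℕ) : Module.finrank ℝ (topSpace T k) ≤ k := by
  induction k with
  | zero => exact (finrank_bot ℝ E).le
  | succ k ih =>
    have := finiteDimensional_topSpace (T := T) k
    have h1 := Submodule.finrank_add_le_finrank_add_finrank (topSpace T k)
      (Submodule.span ℝ {topVector T (topSpace T k)})
    have h2 := (finrank_span_le_card (R := ℝ) {topVector T (topSpace T k)}).trans_eq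
      (by simp : _ = 1)
    exact h1.trans (add_le_add ih h2)

/-- The norm of a compact positive operator is an eigenvalue. -/
theorem hasEigenvalue_norm (hc : IsCompactOperator T) (hs : (T : E →ₗ[ℝ] E).IsSymmetric)
    (hp : ∀ x, 0 ≤ ⟪T x, x⟫) (h0 : T ≠ 0) :
    Module.End.HasEigenvalue (T : Module.End ℝ E) ‖T‖ := by
  have hn : 0 < ‖T‖ := norm_pos_iff.2 h0
  rw [hc.hasEigenvalue_iff_mem_spectrum hn.ne']
  by_contra h
  have : Nontrivial E := by
    by_contra h'
    rw [not_nontrivial_iff_subsingleton] at h'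
    exact h0 (Subsingleton.elim _ _)
  obtain ⟨ε, hε, hR⟩ := T.rayleighQuotient_le_of_norm_mem_resolventSet (𝕜 := ℝ)
    (by simpa [spectrum] using h)
  have habs : ∀ x, |T.rayleighQuotient x| ≤ ‖T‖ - ε := by
    intro x
    rw [abs_of_nonneg]
    · exact hR x
    · exact div_nonneg (by simpa [ContinuousLinearMap.reApplyInnerSelf_apply] using hp x)
        (sq_nonneg _)
  have h1 := ciSup_le habs
  rw [← ContinuousLinearMap.norm_eq_iSup_rayleighQuotient T hs] at h1
  linarith

theorem exists_top_eigenvector (hc : IsCompactOperator T) (hs : (T : E →ₗ[ℝ] E).IsSymmetric)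
    (hp : ∀ x, 0 ≤ ⟪T x, x⟫) {V : Submodule ℝ E} (hV : ∀ x ∈ V, T x ∈ V)
    (hpos : 0 < normOnCompl T V) :
    ∃ e : E, ‖e‖ = 1 ∧ e ∈ Vᗮ ∧ T e = normOnCompl T V • e := by
  have hs' : ∀ x y, ⟪T x, y⟫ = ⟪x, T y⟫ := hs
  have hVo : ∀ x ∈ Vᗮ, T x ∈ Vᗮ := by
    intro x hx
    rw [Submodule.mem_orthogonal'] at hx ⊢
    intro v hv
    rw [hs']
    exact hx _ (hV v hv)
  change 0 < ‖T ∘L Vᗮ.starProjection‖ at hpos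
  set P := Vᗮ.starProjection with hP
  set S := T ∘L P with hS
  have hPm : ∀ x, P x ∈ Vᗮ := Submodule.starProjection_apply_mem _
  have hSm : ∀ x, S x ∈ Vᗮ := fun x => hVo _ (hPm x)
  have hPs : ∀ x y, ⟪P x, y⟫ = ⟪x, P y⟫ := fun x y =>
    Submodule.inner_starProjection_left_eq_right _ x y
  have hPe : ∀ x ∈ Vᗮ, P x = x := fun x hx => Submodule.starProjection_eq_self_iff.2 hx
  have hform : ∀ x y, ⟪S x, y⟫ = ⟪T (P x), P y⟫ := by
    intro x y
    rw [← hPs, hPe _ (hVo _ (hPm x))]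
    rfl
  have hSc : IsCompactOperator S := hc.comp_clm P
  have hSs : (S : E →ₗ[ℝ] E).IsSymmetric := by
    intro x y
    change ⟪S x, y⟫ = ⟪x, S y⟫
    rw [hform, hs', real_inner_comm, ← hform, real_inner_comm]
  obtain ⟨e, he⟩ := (hasEigenvalue_norm hSc hSs
    (fun x => by rw [hform]; exact hp _) (norm_pos_iff.1 hpos)).exists_hasEigenvector
  have he1 : S e = ‖S‖ • e := he.apply_eq_smul
  have hem : e ∈ Vᗮ := by
    have h1 : e = ‖S‖⁻¹ • S e := by
      rw [he1, smul_smul, inv_mul_cancel₀ hpos.ne', one_smul]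
    rw [h1]
    exact Submodule.smul_mem _ _ (hSm e)
  have hTe : T e = ‖S‖ • e := by rw [← he1, hS, ContinuousLinearMap.comp_apply, hPe e hem]
  have hne : ‖e‖ ≠ 0 := norm_ne_zero_iff.2 he.2
  refine ⟨‖e‖⁻¹ • e, by simp [norm_smul, hne], Submodule.smul_mem _ _ hem, ?_⟩
  rw [map_smul, hTe, smul_comm]
  rfl

theorem topVector_spec (hc : IsCompactOperator T) (hs : (T : E →ₗ[ℝ] E).IsSymmetric)
    (hp : ∀ x, 0 ≤ ⟪T x, x⟫) {V : Submodule ℝ E} (hV : ∀ x ∈ V, T x ∈ V)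
    (hpos : 0 < normOnCompl T V) :
    ‖topVector T V‖ = 1 ∧ topVector T V ∈ Vᗮ ∧
      T (topVector T V) = normOnCompl T V • topVector T V := by
  have h := exists_top_eigenvector hc hs hp hV hpos
  rw [topVector, dif_pos h]
  exact h.choose_spec

theorem map_topVector_mem (V : Submodule ℝ E) :
    T (topVector T V) ∈ Submodule.span ℝ {topVector T V} := by
  rw [topVector]
  split_ifs with h
  · rw [h.choose_spec.2.2]
    exact Submodule.smul_mem _ _ (Submodule.mem_span_singleton_self _)
  · simp

theorem map_mem_topSpace (k : ℕ) : ∀ x ∈ topSpace T k, T x ∈ topSpace T k := by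
  induction k with
  | zero =>
    intro x hx
    rw [(Submodule.mem_bot ℝ).1 hx, map_zero]
    exact Submodule.zero_mem _
  | succ k ih =>
    intro x hx
    obtain ⟨y, hy, z, hz, rfl⟩ := Submodule.mem_sup.1 hx
    obtain ⟨a, rfl⟩ := Submodule.mem_span_singleton.1 hz
    rw [map_add, map_smul]
    exact Submodule.add_mem_sup (ih y hy) (Submodule.smul_mem _ _ (map_topVector_mem _))

theorem topVector_mem_topSpace {i j : ℕ} (hij : i < j) :
    topVector T (topSpace T i) ∈ topSpace T j :=
  topSpace_monotone (Nat.succ_le_of_lt hij)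
    (Submodule.mem_sup_right (Submodule.mem_span_singleton_self _))

/-- A vector orthogonal to the first `k` eigenvectors is orthogonal to their span. -/
theorem mem_topSpace_orthogonal {k : ℕ} {x : E}
    (hx : ∀ i < k, ⟪topVector T (topSpace T i), x⟫ = 0) : x ∈ (topSpace T k)ᗮ := by
  induction k with
  | zero =>
    rw [Submodule.mem_orthogonal]
    intro u hu
    rw [(Submodule.mem_bot ℝ).1 hu, inner_zero_left]
  | succ k ih =>
    have h1 := (Submodule.mem_orthogonal _ _).1 (ih fun i hi => hx i (hi.trans k.lt_succ_self))
    rw [Submodule.mem_orthogonal]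
    intro u hu
    obtain ⟨y, hy, z, hz, rfl⟩ := Submodule.mem_sup.1 hu
    obtain ⟨a, rfl⟩ := Submodule.mem_span_singleton.1 hz
    rw [inner_add_left, h1 y hy, inner_smul_left, hx k k.lt_succ_self]
    simp

theorem map_topVector_topSpace (hc : IsCompactOperator T) (hs : (T : E →ₗ[ℝ] E).IsSymmetric)
    (hp : ∀ x, 0 ≤ ⟪T x, x⟫) {k : ℕ} (hk : 0 < topValue T k) :
    T (topVector T (topSpace T k)) = topValue T k • topVector T (topSpace T k) :=
  (topVector_spec hc hs hp (map_mem_topSpace k) hk).2.2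

theorem orthonormal_topVector (hc : IsCompactOperator T) (hs : (T : E →ₗ[ℝ] E).IsSymmetric)
    (hp : ∀ x, 0 ≤ ⟪T x, x⟫) {ι : Type*} {f : ι → ℕ} (hf : Function.Injective f)
    (hpos : ∀ i, 0 < topValue T (f i)) :
    Orthonormal ℝ fun i => topVector T (topSpace T (f i)) := by
  have h := fun i => topVector_spec hc hs hp (map_mem_topSpace (f i)) (hpos i)
  refine ⟨fun i => (h i).1, fun i j hij => ?_⟩
  rcases lt_or_gt_of_ne (hf.ne hij) with hlt | hlt
  · exact (Submodule.mem_orthogonal _ _).1 (h j).2.1 _ (topVector_mem_topSpace hlt)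
  · exact (Submodule.mem_orthogonal' _ _).1 (h i).2.1 _ (topVector_mem_topSpace hlt)

theorem tendsto_topValue (hc : IsCompactOperator T) (hs : (T : E →ₗ[ℝ] E).IsSymmetric)
    (hp : ∀ x, 0 ≤ ⟪T x, x⟫) : Tendsto (topValue T) atTop (𝓝 0) := by
  have hlim := tendsto_atTop_ciInf (topValue_antitone (T := T))
    ⟨0, by rintro _ ⟨k, rfl⟩; exact topValue_nonneg k⟩
  set L := ⨅ k, topValue T k with hL
  have hle : ∀ k, L ≤ topValue T k := fun k =>
    ciInf_le ⟨0, by rintro _ ⟨k, rfl⟩; exact topValue_nonneg k⟩ k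
  have hL0 : 0 ≤ L := le_ciInf fun k => topValue_nonneg k
  rcases hL0.eq_or_lt with h0 | h0
  · rwa [← h0] at hlim
  exfalso
  -- Otherwise `T` maps an orthonormal sequence to a sequence without a Cauchy subsequence.
  have hpos : ∀ k, 0 < topValue T k := fun k => h0.trans_le (hle k)
  have ho := orthonormal_topVector hc hs hp Function.injective_id hpos
  obtain ⟨K, hK, hK'⟩ := hc.image_closedBall_subset_compact 1
  obtain ⟨y, -, ψ, hψ, hψy⟩ := hK.tendsto_subseq
    (x := fun k => T (topVector T (topSpace T k)))
    (fun k => hK' ⟨_, by simpa using (ho.1 k).le, rfl⟩)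
  obtain ⟨N, hN⟩ := Metric.cauchySeq_iff'.1 hψy.cauchySeq L h0
  have h1 := hN (N + 1) N.le_succ
  have hne : ψ (N + 1) ≠ ψ N := (hψ N.lt_succ_self).ne'
  have h2 : ⟪topVector T (topSpace T (ψ (N + 1))), topVector T (topSpace T (ψ N))⟫ = 0 :=
    ho.2 hne
  have hn1 : ‖topVector T (topSpace T (ψ (N + 1)))‖ = 1 := ho.1 _
  have hn2 : ‖topVector T (topSpace T (ψ N))‖ = 1 := ho.1 _
  simp only [Function.comp_apply] at h1
  rw [dist_eq_norm, map_topVector_topSpace hc hs hp (hpos _),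
    map_topVector_topSpace hc hs hp (hpos _)] at h1
  have h3 : L ^ 2 ≤ ‖topValue T (ψ (N + 1)) • topVector T (topSpace T (ψ (N + 1))) -
      topValue T (ψ N) • topVector T (topSpace T (ψ N))‖ ^ 2 := by
    rw [norm_sub_sq_real, inner_smul_left, inner_smul_right, h2, norm_smul, norm_smul, hn1, hn2,
      mul_one, Real.norm_eq_abs, sq_abs, mul_one, Real.norm_eq_abs, sq_abs]
    have := pow_le_pow_left₀ hL0 (hle (ψ (N + 1))) 2
    simp only [mul_zero, sub_zero]
    linarith [sq_nonneg (topValue T (ψ N))]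
  exact absurd h1 (not_lt.2 (le_of_sq_le_sq h3 (norm_nonneg _)))

theorem upperForm_topValue (T : E →L[ℝ] E) (k : ℕ) :
    UpperForm (fun x => ⟪T x, x⟫) k (topValue T k) := by
  refine ⟨topSpace T k, finiteDimensional_topSpace k, finrank_topSpace_le k, fun x hx => ?_⟩
  refine (real_inner_le_norm _ _).trans ?_
  rw [sq, ← mul_assoc]
  gcongr
  exact apply_le_normOnCompl hx

theorem lowerForm_topValue (hc : IsCompactOperator T) (hs : (T : E →ₗ[ℝ] E).IsSymmetric)
    (hp : ∀ x, 0 ≤ ⟪T x, x⟫) {k : ℕ} (hk : 0 < topValue T k) :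
    LowerForm (fun x => ⟪T x, x⟫) k (topValue T k) := by
  have hle : ∀ i : Fin (k + 1), topValue T k ≤ topValue T i := fun i =>
    topValue_antitone (Nat.lt_succ_iff.1 i.2)
  exact LowerForm.of_orthonormal (T := (T : E →ₗ[ℝ] E))
    (orthonormal_topVector hc hs hp Fin.val_injective fun i => hk.trans_le (hle i))
    (fun i => map_topVector_topSpace hc hs hp (hk.trans_le (hle i))) hle

/-- The eigenvectors found by successive maximization span all eigenspaces for positive
eigenvalues. -/
theorem eigenspace_eq_span_topVector (hc : IsCompactOperator T)
    (hs : (T : E →ₗ[ℝ] E).IsSymmetric) (hp : ∀ x, 0 ≤ ⟪T x, x⟫) {μ : ℝ} (hμ : 0 < μ) :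
    Module.End.eigenspace (T : E →ₗ[ℝ] E) μ =
      Submodule.span ℝ (Set.range fun i : {i : ℕ // topValue T i = μ} =>
        topVector T (topSpace T i)) := by
  have hpos : ∀ i : {i : ℕ // topValue T i = μ}, 0 < topValue T i := fun i => by rwa [i.2]
  have ho := orthonormal_topVector hc hs hp Subtype.val_injective hpos
  have hspan : Submodule.span ℝ (Set.range fun i : {i : ℕ // topValue T i = μ} =>
      topVector T (topSpace T i)) ≤ Module.End.eigenspace (T : E →ₗ[ℝ] E) μ := by
    refine Submodule.span_le.2 ?_
    rintro _ ⟨i, rfl⟩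
    refine Module.End.mem_eigenspace_iff.2 ?_
    refine (map_topVector_topSpace hc hs hp (hpos i)).trans ?_
    rw [i.2]
  refine le_antisymm (fun x hx => ?_) hspan
  have hlt : ∃ k, topValue T k < μ := ((tendsto_topValue hc hs hp).eventually_lt_const hμ).exists
  have hfin : Finite {i : ℕ // topValue T i = μ} := by
    obtain ⟨k, hk⟩ := hlt
    refine Set.Finite.subset (Set.finite_Iio k) fun i hi => ?_
    by_contra h
    have := topValue_antitone (T := T) (not_lt.1 h)
    have hi' : topValue T i = μ := hi
    rw [hi'] at this
    exact absurd (this.trans_lt hk) (lt_irrefl _)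
  have := Fintype.ofFinite {i : ℕ // topValue T i = μ}
  set p := ∑ i : {i : ℕ // topValue T i = μ},
    ⟪topVector T (topSpace T i), x⟫ • topVector T (topSpace T i) with hpdef
  have hpm : p ∈ Submodule.span ℝ (Set.range fun i : {i : ℕ // topValue T i = μ} =>
      topVector T (topSpace T i)) :=
    Submodule.sum_mem _ fun i _ => Submodule.smul_mem _ _ (Submodule.subset_span ⟨i, rfl⟩)
  have hy : T (x - p) = μ • (x - p) :=
    Module.End.mem_eigenspace_iff.1 (Submodule.sub_mem _ hx (hspan hpm))
  suffices h : x - p = 0 by rwa [sub_eq_zero.1 h]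
  have hmem : x - p ∈ (topSpace T (Nat.find hlt))ᗮ := by
    refine mem_topSpace_orthogonal fun i hi => ?_
    have hi' : μ ≤ topValue T i := not_lt.1 (Nat.find_min hlt hi)
    rcases hi'.eq_or_lt with h | h
    · have := ho.inner_right_fintype (fun i => ⟪topVector T (topSpace T i), x⟫) ⟨i, h.symm⟩
      rw [inner_sub_right, hpdef, this, sub_self]
    · have h1 := hs (topVector T (topSpace T i)) (x - p)
      simp only [ContinuousLinearMap.coe_coe] at h1
      rw [hy, map_topVector_topSpace hc hs hp (hμ.trans h), inner_smul_left, inner_smul_right,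
        conj_trivial] at h1
      have h2 : (topValue T i - μ) * ⟪topVector T (topSpace T i), x - p⟫ = 0 := by linarith
      exact (mul_eq_zero.1 h2).resolve_left (by linarith)
  have h1 := apply_le_normOnCompl (T := T) hmem
  rw [hy, norm_smul, Real.norm_eq_abs, abs_of_pos hμ] at h1
  have h2 : normOnCompl T (topSpace T (Nat.find hlt)) < μ := Nat.find_spec hlt
  by_contra hne
  have h3 : 0 < ‖x - p‖ := norm_pos_iff.2 hne
  nlinarith

theorem isSpectralSequence_topValue {F : Type} [NormedAddCommGroup F] [InnerProductSpace ℝ F]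
    [CompleteSpace F] {T : F →L[ℝ] F} (hc : IsCompactOperator T)
    (hs : (T : F →ₗ[ℝ] F).IsSymmetric) (hp : ∀ x, 0 ≤ ⟪T x, x⟫) :
    IsSpectralSequence T (topValue T) := by
  have hmult : ∀ μ : ℝ, μ ≠ 0 → Module.rank ℝ (Module.End.eigenspace (T : F →ₗ[ℝ] F) μ) =
      Cardinal.mk {i : ℕ // topValue T i = μ} := by
    intro μ hμ
    rcases hμ.lt_or_gt with h | h
    · have h1 : Module.End.eigenspace (T : F →ₗ[ℝ] F) μ = ⊥ := by
        refine (Submodule.eq_bot_iff _).2 fun x hx => ?_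
        have h2 := hp x
        have h3 : T x = μ • x := Module.End.mem_eigenspace_iff.1 hx
        rw [h3, inner_smul_left, real_inner_self_eq_norm_sq, conj_trivial] at h2
        by_contra hx0
        have : 0 < ‖x‖ := norm_pos_iff.2 hx0
        nlinarith [sq_pos_of_pos this]
      have h2 : IsEmpty {i : ℕ // topValue T i = μ} :=
        ⟨fun i => by have := topValue_nonneg (T := T) i; rw [i.2] at this; linarith⟩
      rw [h1, rank_bot, Cardinal.mk_eq_zero]
    · have ho := orthonormal_topVector hc hs hp
        (f := fun i : {i : ℕ // topValue T i = μ} => (i : ℕ)) Subtype.val_injective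
        (fun i => by rwa [i.2])
      rw [eigenspace_eq_span_topVector hc hs hp h, rank_span ho.linearIndependent,
        Cardinal.mk_range_eq _ ho.linearIndependent.injective]
  refine ⟨topValue_antitone, topValue_nonneg, tendsto_topValue hc hs hp, ?_, hmult⟩
  ext μ
  simp only [Set.mem_sdiff, Set.mem_singleton_iff, Set.mem_range]
  refine and_congr_left fun hμ => ?_
  rw [← hc.hasEigenvalue_iff_mem_spectrum hμ, Module.End.hasEigenvalue_iff, ne_eq,
    ← Submodule.rank_eq_zero, hmult μ hμ, Cardinal.mk_eq_zero_iff, not_isEmpty_iff,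
    nonempty_subtype]

end SpectralSequence

/-! ### The feature map of the arc-cosine kernel -/

section FeatureMap

open scoped TensorProduct

variable {d : ℕ}

/-- The Hilbert space `L²(N(0, I); ℝ^d)`, the range of a feature map of the arc-cosine kernel. -/
abbrev FeatureSpace (d : ℕ) : Type := Lp (Feat d) 2 (stdGaussian (Feat d))

theorem measurableSet_halfSpace (x : Feat d) : MeasurableSet {w : Feat d | 0 < ⟪w, x⟫} :=
  measurableSet_lt measurable_const (by fun_prop)

/-- The feature map `x ↦ (w ↦ 𝟙{⟪w, x⟫ > 0} x)` of the arc-cosine kernel. -/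
noncomputable def featureMap (x : Sph d) : FeatureSpace d :=
  indicatorConstLp 2 (measurableSet_halfSpace (x : Feat d)) (by finiteness) (x : Feat d)

theorem inner_featureMap (x s : Sph d) : ⟪featureMap x, featureMap s⟫ = arcKernel x s := by
  have hset : {w : Feat d | 0 < ⟪w, (x : Feat d)⟫} ∩ {w : Feat d | 0 < ⟪w, (s : Feat d)⟫} =
      {w | 0 < ⟪w, (x : Feat d)⟫ ∧ 0 < ⟪w, (s : Feat d)⟫} := rfl
  have h0 : 0 ≤ (Real.pi - Real.arccos ⟪(x : Feat d), (s : Feat d)⟫) / (2 * Real.pi) :=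
    div_nonneg (sub_nonneg.2 (Real.arccos_le_pi _)) (by positivity)
  rw [featureMap, featureMap, L2.inner_indicatorConstLp_indicatorConstLp, hset, measureReal_def,
    stdGaussian_halfSpace_inter, ENNReal.toReal_ofReal h0, arcKernel, smul_eq_mul]
  ring

theorem arcKernel_self (x : Sph d) : arcKernel x x = 1 / 2 := by
  have hx : ⟪(x : Feat d), (x : Feat d)⟫ = 1 := by
    rw [real_inner_self_eq_norm_sq]; simp
  rw [arcKernel, hx, Real.arccos_one, sub_zero]
  field_simp

theorem norm_featureMap_sq (x : Sph d) : ‖featureMap x‖ ^ 2 = 1 / 2 := by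
  rw [← real_inner_self_eq_norm_sq, inner_featureMap, arcKernel_self]

theorem norm_featureMap_le (x : Sph d) : ‖featureMap x‖ ≤ 1 :=
  le_of_sq_le_sq (by rw [norm_featureMap_sq]; norm_num) zero_le_one

theorem continuous_featureMap : Continuous (featureMap (d := d)) := by
  rw [continuous_iff_continuousAt]
  intro s
  rw [ContinuousAt, tendsto_iff_norm_sub_tendsto_zero]
  have h : ∀ x, ‖featureMap x - featureMap s‖ = √(1 - 2 * arcKernel x s) := by
    intro x
    rw [← Real.sqrt_sq (norm_nonneg _), norm_sub_sq_real, norm_featureMap_sq, norm_featureMap_sq,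
      inner_featureMap]
    ring_nf
  simp only [h]
  have hk : Continuous fun x : Sph d => √(1 - 2 * arcKernel x s) := by
    have : Continuous fun x : Sph d => arcKernel x s :=
      continuous_arcKernel.comp (by fun_prop : Continuous fun x : Sph d => (x, s))
    fun_prop
  simpa [arcKernel_self] using hk.tendsto s

/-- Evaluation of the functions `x ↦ ⟪featureMap x, h⟫` along a probability measure `ρ`, as an
operator into `L²(ρ)`. -/
noncomputable def evalOperator (ρ : Measure (Sph d)) [IsProbabilityMeasure ρ] :
    FeatureSpace d →L[ℝ] Lp ℝ 2 ρ :=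
  ContinuousMap.toLp 2 ρ ℝ ∘L LinearMap.mkContinuous
    { toFun := fun h => (⟨fun x => ⟪featureMap x, h⟫, by
        have := continuous_featureMap (d := d); fun_prop⟩ : C(Sph d, ℝ))
      map_add' := fun h h' => by ext x; simp [inner_add_right]
      map_smul' := fun c h => by ext x; simp [inner_smul_right] } 1
    (fun h => by
      rw [one_mul]
      refine (ContinuousMap.norm_le _ (norm_nonneg h)).2 fun x => ?_
      refine (abs_real_inner_le_norm (featureMap x) h).trans ?_
      exact mul_le_of_le_one_left (norm_nonneg h) (norm_featureMap_le x))

variable (ρ : Measure (Sph d)) [IsProbabilityMeasure ρ]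

theorem coeFn_evalOperator (h : FeatureSpace d) :
    evalOperator ρ h =ᵐ[ρ] fun x => ⟪featureMap x, h⟫ :=
  ContinuousMap.coeFn_toLp ρ _

theorem norm_evalOperator_sq (h : FeatureSpace d) :
    ‖evalOperator ρ h‖ ^ 2 = ∫ x, ⟪featureMap x, h⟫ ^ 2 ∂ρ := by
  rw [← real_inner_self_eq_norm_sq, L2.inner_def]
  refine integral_congr_ae ?_
  filter_upwards [coeFn_evalOperator ρ h] with x hx
  rw [hx, real_inner_self_eq_norm_sq, Real.norm_eq_abs, sq_abs]

theorem norm_evalOperator_le {h : FeatureSpace d} {C : ℝ} (hC : 0 ≤ C)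
    (hh : ∀ x : Sph d, |⟪featureMap x, h⟫| ≤ C) : ‖evalOperator ρ h‖ ≤ C := by
  refine (Lp.norm_le_of_ae_bound hC ?_).trans_eq (by simp [measureUnivNNReal])
  filter_upwards [coeFn_evalOperator ρ h] with x hx
  rw [hx]
  exact hh x

/-- The integral operator of the kernel factors through its feature space. -/
theorem arcOperator_eq : arcOperator ρ = evalOperator ρ ∘L (evalOperator ρ).adjoint := by
  ext1 f
  refine Lp.ext ?_
  refine (coeFn_arcOperator ρ f).trans (EventuallyEq.trans ?_ (coeFn_evalOperator ρ _).symm)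
  refine Eventually.of_forall fun x => ?_
  change ∫ s, arcKernel x s * f s ∂ρ = ⟪featureMap x, (evalOperator ρ).adjoint f⟫
  rw [ContinuousLinearMap.adjoint_inner_right, L2.inner_def]
  refine integral_congr_ae ?_
  filter_upwards [coeFn_evalOperator ρ (featureMap x)] with s hs
  rw [hs, inner_featureMap, arcKernel, arcKernel, real_inner_comm]
  simp [mul_comm]

theorem inner_arcOperator (f : Lp ℝ 2 ρ) :
    ⟪arcOperator ρ f, f⟫ = ‖(evalOperator ρ).adjoint f‖ ^ 2 := by
  rw [arcOperator_eq, ContinuousLinearMap.comp_apply, ← ContinuousLinearMap.adjoint_inner_right,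
    real_inner_self_eq_norm_sq]

theorem isSymmetric_arcOperator : (arcOperator ρ : Lp ℝ 2 ρ →ₗ[ℝ] Lp ℝ 2 ρ).IsSymmetric := by
  intro f g
  simp only [arcOperator_eq, ContinuousLinearMap.coe_coe, ContinuousLinearMap.comp_apply]
  rw [← ContinuousLinearMap.adjoint_inner_right, ContinuousLinearMap.adjoint_inner_left]

/-- The range of the feature map is compact, so up to `ε` it lies in a finite-dimensional
subspace; projecting to such subspaces approximates the operator by operators of finite rank. -/
theorem isCompactOperator_evalOperator : IsCompactOperator (evalOperator ρ) := by
  have hcl := isClosed_setOfPred_isCompactOperator (σ₁₂ := RingHom.id ℝ) (M₁ := FeatureSpace d)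
    (M₂ := Lp ℝ 2 ρ)
  refine hcl.closure_subset (Metric.mem_closure_iff.2 fun ε hε => ?_)
  obtain ⟨t, -, htf, ht⟩ := (isCompact_range (continuous_featureMap (d := d))).finite_cover_balls
    (half_pos hε)
  set V : Submodule ℝ (FeatureSpace d) := Submodule.span ℝ t with hV
  have hVf : FiniteDimensional ℝ V := FiniteDimensional.span_of_finite ℝ htf
  refine ⟨evalOperator ρ ∘L V.starProjection, ?_, ?_⟩
  · have hVp : ProperSpace V := FiniteDimensional.proper ℝ V
    have h1 : IsCompactOperator (V.subtypeL : V → FeatureSpace d) :=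
      isCompactOperator_of_locallyCompactSpace_rng V.subtypeL
    exact (h1.comp_clm V.orthogonalProjectionOnto).clm_comp (evalOperator ρ)
  · rw [dist_eq_norm]
    refine (ContinuousLinearMap.opNorm_le_bound _ (half_pos hε).le fun h => ?_).trans_lt
      (half_lt_self hε)
    have e : (evalOperator ρ - evalOperator ρ ∘L V.starProjection) h =
        evalOperator ρ (h - V.starProjection h) := by simp
    rw [e]
    have horth : h - V.starProjection h ∈ Vᗮ := V.sub_starProjection_mem_orthogonal h
    have hnorm : ‖h - V.starProjection h‖ ≤ ‖h‖ := by
      rw [← V.starProjection_orthogonal_val]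
      exact Submodule.norm_starProjection_apply_le _ _
    refine norm_evalOperator_le ρ (by positivity) fun x => ?_
    obtain ⟨v, hv, hxv⟩ := Set.mem_iUnion₂.1 (ht ⟨x, rfl⟩)
    have h0 : ⟪v, h - V.starProjection h⟫ = 0 :=
      (Submodule.mem_orthogonal _ _).1 horth v (Submodule.subset_span hv)
    rw [← sub_zero ⟪featureMap x, h - V.starProjection h⟫, ← h0, ← inner_sub_left]
    refine (abs_real_inner_le_norm _ _).trans ?_
    rw [Metric.mem_ball, dist_eq_norm] at hxv
    gcongr

theorem isCompactOperator_arcOperator : IsCompactOperator (arcOperator ρ) := by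
  rw [arcOperator_eq]
  exact (isCompactOperator_evalOperator ρ).comp_clm _

/-- The spectral sequence of the kernel operator. -/
noncomputable def arcSpectrum (k : ℕ) : ℝ := topValue (arcOperator ρ) k

theorem isSpectralSequence_arcSpectrum : IsSpectralSequence (arcOperator ρ) (arcSpectrum ρ) :=
  isSpectralSequence_topValue (isCompactOperator_arcOperator ρ) (isSymmetric_arcOperator ρ)
    fun f => by rw [inner_arcOperator]; positivity

theorem upperForm_arcSpectrum (k : ℕ) :
    UpperForm (fun h => ‖evalOperator ρ h‖ ^ 2) k (arcSpectrum ρ k) := by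
  refine UpperForm.of_adjoint (topValue_nonneg k) ?_
  simp only [← inner_arcOperator]
  exact upperForm_topValue (arcOperator ρ) k

theorem lowerForm_arcSpectrum {k : ℕ} (hk : 0 < arcSpectrum ρ k) :
    LowerForm (fun h => ‖evalOperator ρ h‖ ^ 2) k (arcSpectrum ρ k) := by
  refine LowerForm.of_adjoint hk ?_
  simp only [← inner_arcOperator]
  exact lowerForm_topValue (isCompactOperator_arcOperator ρ) (isSymmetric_arcOperator ρ)
    (fun f => by rw [inner_arcOperator]; positivity) hk

/-! ### The kernel matrix of a sample -/

variable {n : ℕ}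

/-- The normalized kernel matrix of a sample, the limit of `Hmat` for infinitely many neurons. -/
noncomputable def kernelMatrix (x : Fin n → Sph d) : Matrix (Fin n) (Fin n) ℝ :=
  Matrix.of fun i i' => 1 / (n : ℝ) * arcKernel (x i) (x i')

theorem kernelMatrix_isHermitian (x : Fin n → Sph d) : (kernelMatrix x).IsHermitian := by
  refine Matrix.IsHermitian.ext fun i i' => ?_
  simp only [kernelMatrix, Matrix.of_apply, star_trivial]
  rw [← inner_featureMap, ← inner_featureMap, real_inner_comm]

/-- The synthesis operator `u ↦ n^{-1/2} ∑ u_i featureMap (x_i)` of a sample. -/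
noncomputable def synthesis (x : Fin n → Sph d) : EuclideanSpace ℝ (Fin n) →L[ℝ] FeatureSpace d :=
  LinearMap.toContinuousLinearMap
    { toFun := fun u => ∑ i, (u i / √n) • featureMap (x i)
      map_add' := fun u v => by simp [add_div, add_smul, Finset.sum_add_distrib]
      map_smul' := fun c u => by simp [mul_div_assoc, Finset.smul_sum, smul_smul] }

theorem synthesis_apply (x : Fin n → Sph d) (u : EuclideanSpace ℝ (Fin n)) :
    synthesis x u = ∑ i, (u i / √n) • featureMap (x i) := rfl

theorem inner_kernelMatrix (x : Fin n → Sph d) (u : EuclideanSpace ℝ (Fin n)) :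
    ⟪Matrix.toEuclideanLin (kernelMatrix x) u, u⟫ = ‖synthesis x u‖ ^ 2 := by
  rw [← real_inner_self_eq_norm_sq, synthesis_apply, sum_inner, PiLp.inner_apply]
  refine Finset.sum_congr rfl fun i _ => ?_
  rw [inner_sum, Matrix.toLpLin_apply]
  simp only [Matrix.mulVec, dotProduct, kernelMatrix, Matrix.of_apply, inner_smul_left,
    inner_smul_right, inner_featureMap, RCLike.inner_apply, conj_trivial, Finset.mul_sum]
  refine Finset.sum_congr rfl fun j _ => ?_
  have hn : (1 : ℝ) / n = (1 / √n) * (1 / √n) := by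
    rw [← mul_div_mul_comm, one_mul, Real.mul_self_sqrt (by positivity)]
  rw [hn]
  ring

theorem norm_adjoint_synthesis_sq (x : Fin n → Sph d) (h : FeatureSpace d) :
    ‖(synthesis x).adjoint h‖ ^ 2 = 1 / (n : ℝ) * ∑ i, ⟪featureMap (x i), h⟫ ^ 2 := by
  rw [EuclideanSpace.real_norm_sq_eq, Finset.mul_sum]
  refine Finset.sum_congr rfl fun i _ => ?_
  have h1 : ((synthesis x).adjoint h) i =
      ⟪EuclideanSpace.single i (1 : ℝ), (synthesis x).adjoint h⟫ := by
    rw [EuclideanSpace.inner_single_left, map_one, one_mul]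
  rw [h1, ContinuousLinearMap.adjoint_inner_right, synthesis_apply]
  have h2 : (∑ j, ((EuclideanSpace.single i (1 : ℝ)) j / √n) • featureMap (x j)) =
      (1 / √n) • featureMap (x i) := by
    rw [Finset.sum_eq_single i] <;> simp +contextual
  rw [h2, inner_smul_left, mul_pow]
  simp

/-- The eigenvalues of a Hermitian matrix in non-increasing order, continued by `0`. -/
noncomputable def eigSeq {M : Matrix (Fin n) (Fin n) ℝ} (hM : M.IsHermitian) (i : ℕ) : ℝ :=
  if h : i < n then hM.eigenvalues₀ ⟨i, by simpa using h⟩ else 0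

section eigSeq

variable {M : Matrix (Fin n) (Fin n) ℝ} (hM : M.IsHermitian)

theorem lowerForm_eigSeq {k : ℕ} (hk : k < n) :
    LowerForm (fun u => ⟪Matrix.toEuclideanLin M u, u⟫) k (eigSeq hM k) := by
  rw [eigSeq, dif_pos hk]
  exact LinearMap.IsSymmetric.lowerForm_eigenvalues
    (Matrix.isSymmetric_toEuclideanLin_iff.mpr hM) finrank_euclideanSpace ⟨k, by simpa using hk⟩

theorem upperForm_eigSeq (k : ℕ) :
    UpperForm (fun u => ⟪Matrix.toEuclideanLin M u, u⟫) k (eigSeq hM k) := by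
  by_cases hk : k < n
  · rw [eigSeq, dif_pos hk]
    exact LinearMap.IsSymmetric.upperForm_eigenvalues
      (Matrix.isSymmetric_toEuclideanLin_iff.mpr hM) finrank_euclideanSpace ⟨k, by simpa using hk⟩
  · refine ⟨⊤, inferInstance, by simpa using hk, fun u hu => ?_⟩
    have : u = 0 := by simpa using hu
    simp [this]

/-- Weyl's inequality for the eigenvalues of Hermitian matrices. -/
theorem abs_eigSeq_sub_le {M' : Matrix (Fin n) (Fin n) ℝ} (hM' : M'.IsHermitian) {t : ℝ}
    (ht : 0 ≤ t) (h : ∀ u : EuclideanSpace ℝ (Fin n), |⟪Matrix.toEuclideanLin M u, u⟫ -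
      ⟪Matrix.toEuclideanLin M' u, u⟫| ≤ t * ‖u‖ ^ 2) (k : ℕ) :
    |eigSeq hM k - eigSeq hM' k| ≤ t := by
  by_cases hk : k < n
  · rw [abs_sub_le_iff]
    have h1 := (lowerForm_eigSeq hM hk).le_add (ε := t) (upperForm_eigSeq hM' k)
      (fun u => by linarith [(abs_sub_le_iff.1 (h u)).1])
    have h2 := (lowerForm_eigSeq hM' hk).le_add (ε := t) (upperForm_eigSeq hM k)
      (fun u => by linarith [(abs_sub_le_iff.1 (h u)).2])
    constructor <;> linarith
  · simpa [eigSeq, hk] using ht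

end eigSeq

theorem eigSeq_kernelMatrix_nonneg (x : Fin n → Sph d) (k : ℕ) :
    0 ≤ eigSeq (kernelMatrix_isHermitian x) k := by
  by_cases hk : k < n
  · have hz : LowerForm (fun _ : EuclideanSpace ℝ (Fin n) => (0 : ℝ)) k 0 :=
      ⟨⊤, inferInstance, by simpa using hk, by simp⟩
    have := hz.le_add (ε := 0) (upperForm_eigSeq (kernelMatrix_isHermitian x) k) fun u => by
      rw [inner_kernelMatrix]
      positivity
    rwa [add_zero] at this
  · simp [eigSeq, hk]

theorem upperForm_kernelMatrix (x : Fin n → Sph d) (k : ℕ) :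
    UpperForm (fun h => ‖(synthesis x).adjoint h‖ ^ 2) k
      (eigSeq (kernelMatrix_isHermitian x) k) := by
  refine UpperForm.of_adjoint (eigSeq_kernelMatrix_nonneg x k) ?_
  simp only [ContinuousLinearMap.adjoint_adjoint, ← inner_kernelMatrix]
  exact upperForm_eigSeq _ k

theorem lowerForm_kernelMatrix (x : Fin n → Sph d) {k : ℕ}
    (hk : 0 < eigSeq (kernelMatrix_isHermitian x) k) :
    LowerForm (fun h => ‖(synthesis x).adjoint h‖ ^ 2) k
      (eigSeq (kernelMatrix_isHermitian x) k) := by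
  refine LowerForm.of_adjoint hk ?_
  simp only [ContinuousLinearMap.adjoint_adjoint, ← inner_kernelMatrix]
  refine lowerForm_eigSeq _ ?_
  by_contra h
  simp [eigSeq, h] at hk

/-! ### Deviation of the empirical from the expected feature tensor -/

/-- The Hilbert tensor square of the feature space, in place of the Hilbert–Schmidt operators. -/
abbrev TensorSpace (d : ℕ) : Type :=
  UniformSpace.Completion (FeatureSpace d ⊗[ℝ] FeatureSpace d)

/-- The feature tensor `φ(x) ⊗ φ(x)`. -/
noncomputable def featureTensor (x : Sph d) : TensorSpace d :=
  ((featureMap x ⊗ₜ[ℝ] featureMap x : FeatureSpace d ⊗[ℝ] FeatureSpace d) : TensorSpace d)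

theorem inner_featureTensor (x : Sph d) (h : FeatureSpace d) :
    ⟪featureTensor x, ((h ⊗ₜ[ℝ] h : FeatureSpace d ⊗[ℝ] FeatureSpace d) : TensorSpace d)⟫ =
      ⟪featureMap x, h⟫ ^ 2 := by
  rw [featureTensor, UniformSpace.Completion.inner_coe, TensorProduct.inner_tmul, sq]

theorem norm_featureTensor (x : Sph d) : ‖featureTensor x‖ = 1 / 2 := by
  rw [featureTensor, UniformSpace.Completion.norm_coe, TensorProduct.norm_tmul, ← sq,
    norm_featureMap_sq]

theorem continuous_featureTensor : Continuous (featureTensor (d := d)) := by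
  have := continuous_featureMap (d := d)
  exact (UniformSpace.Completion.continuous_coe _).comp
    (TensorProduct.continuous_tmul.comp (this.prodMk this))

theorem stronglyMeasurable_featureTensor : StronglyMeasurable (featureTensor (d := d)) := by
  have : SecondCountableTopologyEither (Sph d) (TensorSpace d) :=
    secondCountableTopologyEither_of_left _ _
  exact continuous_featureTensor.stronglyMeasurable

theorem integrable_featureTensor : Integrable (featureTensor (d := d)) ρ :=
  .of_bound stronglyMeasurable_featureTensor.aestronglyMeasurable (1 / 2)
    (Eventually.of_forall fun x => (norm_featureTensor x).le)

/-- The centred feature tensor. -/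
noncomputable def centredTensor (x : Sph d) : TensorSpace d :=
  featureTensor x - ∫ s, featureTensor s ∂ρ

theorem norm_centredTensor_le (x : Sph d) : ‖centredTensor ρ x‖ ≤ 1 := by
  have h1 : ‖∫ s, featureTensor s ∂ρ‖ ≤ 1 / 2 := by
    simpa using norm_integral_le_of_norm_le_const (μ := ρ)
      (Eventually.of_forall fun x => (norm_featureTensor (d := d) x).le)
  have h2 := norm_sub_le (featureTensor x) (∫ s, featureTensor s ∂ρ)
  rw [norm_featureTensor] at h2
  rw [centredTensor]
  linarith

theorem integral_centredTensor : ∫ x, centredTensor ρ x ∂ρ = 0 := by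
  simp only [centredTensor]
  rw [integral_sub (integrable_featureTensor ρ) (integrable_const _)]
  simp

/-- The forms of the empirical and of the true covariance differ by at most the norm of the
deviation of the mean feature tensor. -/
theorem abs_norm_sq_sub_norm_sq_le (hn : 1 ≤ n) (x : Fin n → Sph d) (h : FeatureSpace d) :
    |‖(synthesis x).adjoint h‖ ^ 2 - ‖evalOperator ρ h‖ ^ 2| ≤
      ‖∑ i, centredTensor ρ (x i)‖ / n * ‖h‖ ^ 2 := by
  have hn0 : (0 : ℝ) < n := by exact_mod_cast hn
  set hh : TensorSpace d := ((h ⊗ₜ[ℝ] h : FeatureSpace d ⊗[ℝ] FeatureSpace d) : TensorSpace d)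
    with hhh
  have h1 : ⟪∑ i, centredTensor ρ (x i), hh⟫ =
      n * (‖(synthesis x).adjoint h‖ ^ 2 - ‖evalOperator ρ h‖ ^ 2) := by
    have h2 : ⟪∫ s, featureTensor s ∂ρ, hh⟫ = ∫ s, ⟪featureMap s, h⟫ ^ 2 ∂ρ := by
      rw [real_inner_comm, ← integral_inner (integrable_featureTensor ρ)]
      refine integral_congr_ae (Eventually.of_forall fun s => ?_)
      simp only
      rw [real_inner_comm, inner_featureTensor]
    rw [sum_inner, norm_adjoint_synthesis_sq, norm_evalOperator_sq, ← h2]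
    simp only [centredTensor, inner_sub_left, hhh, inner_featureTensor, Finset.sum_sub_distrib]
    simp
    field_simp
  have h3 : ‖hh‖ = ‖h‖ ^ 2 := by
    rw [hhh, UniformSpace.Completion.norm_coe, TensorProduct.norm_tmul, sq]
  have h4 := abs_real_inner_le_norm (∑ i, centredTensor ρ (x i)) hh
  rw [h1, abs_mul, abs_of_pos hn0, h3] at h4
  rw [div_mul_eq_mul_div, le_div_iff₀ hn0]
  linarith

/-- The eigenvalues of the kernel matrix of a sample approximate those of the kernel operator,
uniformly in the index. -/
theorem abs_arcSpectrum_sub_eigSeq_le (hn : 1 ≤ n) (x : Fin n → Sph d) (k : ℕ) :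
    |arcSpectrum ρ k - eigSeq (kernelMatrix_isHermitian x) k| ≤
      ‖∑ i, centredTensor ρ (x i)‖ / n := by
  have hdev := abs_norm_sq_sub_norm_sq_le ρ hn x
  have hnn : 0 ≤ ‖∑ i, centredTensor ρ (x i)‖ / n := by positivity
  have ha := (isSpectralSequence_arcSpectrum ρ).nonneg k
  have hb := eigSeq_kernelMatrix_nonneg x k
  rw [abs_sub_le_iff]
  constructor
  · rcases ha.eq_or_lt with h0 | h0
    · linarith
    · have := (lowerForm_arcSpectrum ρ h0).le_add (ε := ‖∑ i, centredTensor ρ (x i)‖ / n)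
        (upperForm_kernelMatrix x k)
        (fun h => by linarith [(abs_sub_le_iff.1 (hdev h)).2])
      linarith
  · rcases hb.eq_or_lt with h0 | h0
    · linarith
    · have := (lowerForm_kernelMatrix x h0).le_add (ε := ‖∑ i, centredTensor ρ (x i)‖ / n)
        (upperForm_arcSpectrum ρ k)
        (fun h => by linarith [(abs_sub_le_iff.1 (hdev h)).1])
      linarith

end FeatureMap

/-! ### Concentration of the activation frequencies -/

/-- Hoeffding's inequality for the frequency of a measurable set among independent samples. -/
theorem measure_frequency_deviation_le {Ω : Type*} [MeasurableSpace Ω] (P : Measure Ω)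
    [IsProbabilityMeasure P] {S : Set Ω} (hS : MeasurableSet S) {m : ℕ} (hm : 1 ≤ m) {t : ℝ}
    (ht : 0 ≤ t) :
    (Measure.pi fun _ : Fin m => P)
        {w | t ≤ |(∑ j, S.indicator (fun _ => (1 : ℝ)) (w j)) / m - P.real S|} ≤
      ENNReal.ofReal (2 * Real.exp (-(2 * m * t ^ 2))) := by
  have hm0 : (0 : ℝ) < m := by exact_mod_cast hm
  set Q := Measure.pi fun _ : Fin m => P with hQ
  set f : Ω → ℝ := S.indicator fun _ => 1 with hf
  have hfm : Measurable f := measurable_const.indicator hS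
  have hint : ∀ j : Fin m, ∫ w, f (w j) ∂Q = P.real S := by
    intro j
    rw [hQ, integral_comp_eval hfm.aestronglyMeasurable, hf, integral_indicator_const _ hS]
    simp
  have hmem : ∀ w, f w ∈ Set.Icc (0 : ℝ) 1 := by
    intro w
    by_cases h : w ∈ S <;> simp [hf, h]
  have hsub : ∀ j : Fin m, HasSubgaussianMGF (fun w : Fin m → Ω => f (w j) - P.real S)
      ((‖(1 : ℝ) - 0‖₊ / 2) ^ 2) Q := by
    intro j
    have := hasSubgaussianMGF_of_mem_Icc (μ := Q) (X := fun w : Fin m → Ω => f (w j))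
      (hfm.comp (measurable_pi_apply j)).aemeasurable (Eventually.of_forall fun w => hmem (w j))
    rwa [hint j] at this
  have hind : iIndepFun (fun (j : Fin m) (w : Fin m → Ω) => f (w j) - P.real S) Q :=
    iIndepFun_pi (X := fun _ ω => f ω - P.real S) fun _ => (hfm.sub_const _).aemeasurable
  have hind' : iIndepFun (fun (j : Fin m) (w : Fin m → Ω) => -(f (w j) - P.real S)) Q :=
    iIndepFun_pi (X := fun _ ω => -(f ω - P.real S)) fun _ => (hfm.sub_const _).neg.aemeasurable
  have hmt : 0 ≤ m * t := by positivity
  have hexp : Real.exp (-(m * t) ^ 2 / (2 * ((∑ _j : Fin m,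
      (‖(1 : ℝ) - 0‖₊ / 2) ^ 2 : NNReal) : ℝ))) = Real.exp (-(2 * m * t ^ 2)) := by
    congr 1
    simp
    field_simp
  have h1 := HasSubgaussianMGF.measure_sum_ge_le_of_iIndepFun hind (s := Finset.univ)
    (fun j _ => hsub j) hmt
  have h2 := HasSubgaussianMGF.measure_sum_ge_le_of_iIndepFun hind' (s := Finset.univ)
    (fun j _ => (hsub j).neg) hmt
  rw [hexp] at h1 h2
  have hsubset : {w : Fin m → Ω | t ≤ |(∑ j, f (w j)) / m - P.real S|} ⊆
      {w | m * t ≤ ∑ j, (f (w j) - P.real S)} ∪ {w | m * t ≤ ∑ j, -(f (w j) - P.real S)} := by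
    intro w hw
    have hw' : t ≤ |(∑ j, f (w j)) / m - P.real S| := hw
    have e : (∑ j, f (w j)) / m - P.real S = (∑ j, (f (w j) - P.real S)) / m := by
      rw [Finset.sum_sub_distrib]
      simp
      field_simp
    rw [e] at hw'
    rcases le_abs.1 hw' with h | h
    · left
      rw [le_div_iff₀ hm0] at h
      change m * t ≤ _
      linarith
    · right
      rw [← neg_div, le_div_iff₀ hm0] at h
      change m * t ≤ _
      rw [Finset.sum_neg_distrib]
      linarith
  refine (measure_mono hsubset).trans ((measure_union_le _ _).trans ?_)
  rw [two_mul, ENNReal.ofReal_add (by positivity) (by positivity)]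
  refine add_le_add ?_ ?_
  · rw [← ofReal_measureReal]
    exact ENNReal.ofReal_le_ofReal h1
  · rw [← ofReal_measureReal]
    exact ENNReal.ofReal_le_ofReal h2

section Network

variable {d n m : ℕ}

/-- The proportion of the neurons that are active both at `x` and at `s`, minus its expectation. -/
noncomputable def activationDeviation (w : Fin m → Feat d) (x s : Sph d) : ℝ :=
  (∑ j, {v : Feat d | 0 < ⟪v, (x : Feat d)⟫ ∧ 0 < ⟪v, (s : Feat d)⟫}.indicator
    (fun _ => (1 : ℝ)) (w j)) / m -
    (Real.pi - Real.arccos ⟪(x : Feat d), (s : Feat d)⟫) / (2 * Real.pi)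

theorem activationDeviation_comm (w : Fin m → Feat d) (x s : Sph d) :
    activationDeviation w x s = activationDeviation w s x := by
  unfold activationDeviation
  rw [real_inner_comm]
  simp only [and_comm]

theorem Hmat_apply (a : Fin m → ℤˣ) (w : Fin m → Feat d) (x : Fin n → Sph d) (i i' : Fin n) :
    Hmat a w x i i' = 1 / ((n : ℝ) * m) * ⟪(x i : Feat d), (x i' : Feat d)⟫ *
      ∑ j, {v : Feat d | 0 < ⟪v, (x i : Feat d)⟫ ∧ 0 < ⟪v, (x i' : Feat d)⟫}.indicator
        (fun _ => (1 : ℝ)) (w j) := by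
  have hset : (Finset.univ.filter fun j => a j = -1) = Finset.univ.filter fun j => ¬ a j = 1 := by
    ext j
    rcases Int.units_eq_one_or (a j) with h | h <;> simp [h]
  simp only [Hmat, Hplus, Hminus, neuronGram, Matrix.add_apply, Matrix.of_apply]
  rw [hset, ← mul_add, Finset.sum_filter_add_sum_filter_not]
  congr 1
  refine Finset.sum_congr rfl fun j _ => ?_
  by_cases h1 : 0 < ⟪w j, (x i : Feat d)⟫ <;> by_cases h2 : 0 < ⟪w j, (x i' : Feat d)⟫ <;>
    simp [h1, h2]

theorem Hmat_sub_kernelMatrix (hm : 1 ≤ m) (a : Fin m → ℤˣ) (w : Fin m → Feat d)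
    (x : Fin n → Sph d) (i i' : Fin n) :
    Hmat a w x i i' - kernelMatrix x i i' =
      1 / n * ⟪(x i : Feat d), (x i' : Feat d)⟫ * activationDeviation w (x i) (x i') := by
  rw [Hmat_apply, kernelMatrix, Matrix.of_apply, arcKernel, activationDeviation]
  have : (m : ℝ) ≠ 0 := by positivity
  field_simp

/-- A matrix with entries of absolute value at most `t / n` has operator norm at most `t`. -/
theorem abs_inner_toEuclideanLin_le (hn : 1 ≤ n) {M : Matrix (Fin n) (Fin n) ℝ} {t : ℝ}
    (ht : 0 ≤ t) (hM : ∀ i i', |M i i'| ≤ t / n) (u : EuclideanSpace ℝ (Fin n)) :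
    |⟪Matrix.toEuclideanLin M u, u⟫| ≤ t * ‖u‖ ^ 2 := by
  have hn0 : (0 : ℝ) < n := by exact_mod_cast hn
  have e : ⟪Matrix.toEuclideanLin M u, u⟫ = ∑ i, ∑ i', M i i' * u i' * u i := by
    rw [PiLp.inner_apply]
    refine Finset.sum_congr rfl fun i _ => ?_
    rw [Matrix.toLpLin_apply]
    simp [Matrix.mulVec, dotProduct, Finset.mul_sum, mul_comm]
  rw [e, EuclideanSpace.real_norm_sq_eq]
  calc |∑ i, ∑ i', M i i' * u i' * u i|
      ≤ ∑ i, ∑ i', t / n * |u i'| * |u i| := by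
        refine (Finset.abs_sum_le_sum_abs _ _).trans (Finset.sum_le_sum fun i _ => ?_)
        refine (Finset.abs_sum_le_sum_abs _ _).trans (Finset.sum_le_sum fun i' _ => ?_)
        rw [abs_mul, abs_mul]
        gcongr
        exact hM i i'
    _ = t / n * (∑ i, |u i|) ^ 2 := by
        rw [sq, Finset.sum_mul_sum, Finset.mul_sum]
        refine Finset.sum_congr rfl fun i _ => ?_
        rw [Finset.mul_sum]
        exact Finset.sum_congr rfl fun i' _ => by ring
    _ ≤ t / n * (n * ∑ i, u i ^ 2) := by
        gcongr
        have := sq_sum_le_card_mul_sum_sq (s := (Finset.univ : Finset (Fin n)))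
          (f := fun i => |u i|)
        simpa [sq_abs] using this
    _ = _ := by field_simp

theorem abs_eigSeq_kernelMatrix_sub_Heig_le (hn : 1 ≤ n) (hm : 1 ≤ m) (a : Fin m → ℤˣ)
    (w : Fin m → Feat d) (x : Fin n → Sph d) {t : ℝ} (ht : 0 ≤ t)
    (hdev : ∀ i i', |activationDeviation w (x i) (x i')| ≤ t) (k : ℕ) :
    |eigSeq (kernelMatrix_isHermitian x) k - Heig a w x k| ≤ t := by
  have hn0 : (0 : ℝ) < n := by exact_mod_cast hn
  rw [abs_sub_comm]
  refine abs_eigSeq_sub_le (Hmat_isHermitian a w x) (kernelMatrix_isHermitian x) ht (fun u => ?_) k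
  rw [← inner_sub_left, ← LinearMap.sub_apply, ← map_sub]
  refine abs_inner_toEuclideanLin_le hn ht (fun i i' => ?_) u
  rw [Matrix.sub_apply, Hmat_sub_kernelMatrix hm, abs_mul, abs_mul, abs_of_pos (by positivity)]
  have h1 : |⟪(x i : Feat d), (x i' : Feat d)⟫| ≤ 1 := by
    simpa using abs_real_inner_le_norm (x i : Feat d) (x i' : Feat d)
  calc 1 / (n : ℝ) * |⟪(x i : Feat d), (x i' : Feat d)⟫| * |activationDeviation w (x i) (x i')|
      ≤ 1 / n * 1 * t := by gcongr; exact hdev i i'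
    _ = t / n := by ring

theorem measurable_activationDeviation :
    Measurable fun p : (Fin m → Feat d) × Sph d × Sph d => activationDeviation p.1 p.2.1 p.2.2 := by
  have hj : ∀ j : Fin m, Measurable fun p : (Fin m → Feat d) × Sph d × Sph d =>
      {v : Feat d | 0 < ⟪v, (p.2.1 : Feat d)⟫ ∧ 0 < ⟪v, (p.2.2 : Feat d)⟫}.indicator
        (fun _ => (1 : ℝ)) (p.1 j) := by
    intro j
    simp only [Set.indicator_apply, Set.mem_ofPred_eq]
    refine Measurable.ite (measurableSet_pos_and_pos ?_ ?_) measurable_const measurable_const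
    · exact Continuous.measurable (by fun_prop)
    · exact Continuous.measurable (by fun_prop)
  refine ((Finset.measurable_fun_sum _ fun j _ => hj j).div_const _).sub ?_
  refine Measurable.div_const ?_ _
  refine measurable_const.sub (Real.measurable_arccos.comp ?_)
  exact Continuous.measurable (by fun_prop)

/-! ### Deviation bounds under the joint law -/

variable (ρ : Measure (Sph d)) [IsProbabilityMeasure ρ]

instance isProbabilityMeasure_jointLaw (ν : ℝ) : IsProbabilityMeasure (jointLaw ρ ν n m) := by
  unfold jointLaw
  infer_instance

theorem jointLaw_activationDeviation_le {ν : ℝ} (hν : 0 < ν) (hm : 1 ≤ m) {t : ℝ} (ht : 0 ≤ t)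
    (i i' : Fin n) :
    jointLaw ρ ν n m {ω | t ≤ |activationDeviation ω.2.1 (ω.1 i) (ω.1 i')|} ≤
      ENNReal.ofReal (2 * Real.exp (-(2 * m * t ^ 2))) := by
  have hmeas : Measurable fun ω : (Fin n → Sph d) × (Fin m → Feat d) × (Fin m → ℤˣ) =>
      |activationDeviation ω.2.1 (ω.1 i) (ω.1 i')| := by
    have h1 : Measurable fun ω : (Fin n → Sph d) × (Fin m → Feat d) × (Fin m → ℤˣ) =>
        (ω.2.1, ω.1 i, ω.1 i') := by fun_prop
    have h2 := measurable_activationDeviation.comp h1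
    exact continuous_abs.measurable.comp h2
  rw [jointLaw, Measure.prod_apply (measurableSet_le measurable_const hmeas)]
  refine (lintegral_mono (g := fun _ => ENNReal.ofReal (2 * Real.exp (-(2 * m * t ^ 2))))
    fun x => ?_).trans_eq (by simp)
  have hset : (Prod.mk x ⁻¹' {ω : (Fin n → Sph d) × (Fin m → Feat d) × (Fin m → ℤˣ) |
      t ≤ |activationDeviation ω.2.1 (ω.1 i) (ω.1 i')|}) =
      {w : Fin m → Feat d | t ≤ |activationDeviation w (x i) (x i')|} ×ˢ Set.univ := by
    ext p
    simp
  rw [hset, Measure.prod_prod, measure_univ, mul_one]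
  have h := measure_frequency_deviation_le
    (multivariateGaussian (0 : Feat d) (ν ^ 2 • (1 : Matrix (Fin d) (Fin d) ℝ)))
    (measurableSet_halfSpace_inter (x i : Feat d) (x i' : Feat d)) hm ht
  rw [measureReal_def, gaussian_halfSpace_inter hν, ENNReal.toReal_ofReal
    (div_nonneg (sub_nonneg.2 (Real.arccos_le_pi _)) (by positivity))] at h
  exact h

/-- By symmetry of the kernel matrix only the `n (n + 1) / 2` entries on and above the diagonal
contribute to the union bound. -/
theorem jointLaw_exists_activationDeviation_le {ν : ℝ} (hν : 0 < ν) (hm : 1 ≤ m) {t : ℝ}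
    (ht : 0 ≤ t) :
    jointLaw ρ ν n m {ω | ∃ i i', t ≤ |activationDeviation ω.2.1 (ω.1 i) (ω.1 i')|} ≤
      ENNReal.ofReal (n * (n + 1) * Real.exp (-(2 * m * t ^ 2))) := by
  have hsub : {ω : (Fin n → Sph d) × (Fin m → Feat d) × (Fin m → ℤˣ) |
      ∃ i i', t ≤ |activationDeviation ω.2.1 (ω.1 i) (ω.1 i')|} ⊆
      ⋃ i : Fin n, ⋃ i' ∈ Finset.Iic i,
        {ω | t ≤ |activationDeviation ω.2.1 (ω.1 i) (ω.1 i')|} := by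
    rintro ω ⟨i, i', h⟩
    simp only [Set.mem_iUnion]
    rcases le_total i' i with hle | hle
    · exact ⟨i, i', Finset.mem_Iic.2 hle, h⟩
    · refine ⟨i', i, Finset.mem_Iic.2 hle, ?_⟩
      change t ≤ _
      rwa [activationDeviation_comm]
  refine (measure_mono hsub).trans ((measure_iUnion_fintype_le _ _).trans ?_)
  calc ∑ i : Fin n, jointLaw ρ ν n m (⋃ i' ∈ Finset.Iic i,
          {ω | t ≤ |activationDeviation ω.2.1 (ω.1 i) (ω.1 i')|})
      ≤ ∑ i : Fin n, ∑ i' ∈ Finset.Iic i, ENNReal.ofReal (2 * Real.exp (-(2 * m * t ^ 2))) := by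
        refine Finset.sum_le_sum fun i _ => ?_
        refine (measure_biUnion_finset_le _ _).trans (Finset.sum_le_sum fun i' _ => ?_)
        exact jointLaw_activationDeviation_le ρ hν hm ht i i'
    _ = ENNReal.ofReal (∑ i : Fin n, ((i : ℝ) + 1) * (2 * Real.exp (-(2 * m * t ^ 2)))) := by
        rw [ENNReal.ofReal_sum_of_nonneg (fun i _ => by positivity)]
        refine Finset.sum_congr rfl fun i _ => ?_
        rw [Finset.sum_const, Fin.card_Iic, nsmul_eq_mul, ← ENNReal.ofReal_natCast,
          ← ENNReal.ofReal_mul (by positivity)]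
        push_cast
        rfl
    _ = _ := by
        congr 1
        have hg : (∑ i : Fin n, ((i : ℝ) + 1)) * 2 = n * (n + 1) := by
          clear hsub
          rw [Fin.sum_univ_eq_sum_range (fun i => (i : ℝ) + 1) n]
          induction n with
          | zero => simp
          | succ k ih => rw [Finset.sum_range_succ, add_mul, ih]; push_cast; ring
        rw [← Finset.sum_mul, ← mul_assoc, hg]

theorem jointLaw_norm_sum_centredTensor_le {ν : ℝ} {s : ℝ} (hs : 0 ≤ s) :
    jointLaw ρ ν n m {ω | n * s ≤ ‖∑ i, centredTensor ρ (ω.1 i)‖} ≤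
      ENNReal.ofReal (2 * Real.exp (-n * s ^ 2 / 2)) := by
  have hX : StronglyMeasurable (centredTensor ρ) :=
    stronglyMeasurable_featureTensor.sub stronglyMeasurable_const
  have h := measure_norm_sum_ge_le (P := ρ) hX one_pos (norm_centredTensor_le ρ)
    (integral_centredTensor ρ) n hs
  have hsum : StronglyMeasurable fun x : Fin n → Sph d => ∑ i, centredTensor ρ (x i) :=
    Finset.stronglyMeasurable_fun_sum _ fun i _ => hX.comp_measurable (measurable_pi_apply i)
  have hS : MeasurableSet {x : Fin n → Sph d | n * s ≤ ‖∑ i, centredTensor ρ (x i)‖} :=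
    measurableSet_le measurable_const hsum.norm.measurable
  rw [one_pow, mul_one] at h
  refine le_trans (le_of_eq ?_) h
  exact measurePreserving_fst.measure_preimage hS.nullMeasurableSet

/-- The uniform eigenvalue bound fails with probability at most `δ`. -/
theorem jointLaw_eigenvalue_deviation_le {ν δ : ℝ} (hn : 1 ≤ n) (hm : 1 ≤ m) (hν : 0 < ν)
    (hδ : 0 < δ) (hδ1 : δ < 1) :
    jointLaw ρ ν n m {ω | ∀ k : ℕ, |arcSpectrum ρ k - Heig ω.2.2 ω.2.1 ω.1 k| ≤
      √(Real.log (2 * (n : ℝ) ^ 2 / δ) / (2 * (m : ℝ))) +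
        √(8 * Real.log (4 / δ) / (n : ℝ))}ᶜ ≤ ENNReal.ofReal δ := by
  have hn0 : (0 : ℝ) < n := by exact_mod_cast hn
  have hn1 : (1 : ℝ) ≤ n := by exact_mod_cast hn
  have hm0 : (0 : ℝ) < m := by exact_mod_cast hm
  set t := √(Real.log (2 * (n : ℝ) ^ 2 / δ) / (2 * (m : ℝ))) with ht
  set s := √(8 * Real.log (4 / δ) / (n : ℝ)) with hs
  have ht0 : 0 ≤ t := Real.sqrt_nonneg _
  have hs0 : 0 ≤ s := Real.sqrt_nonneg _
  have hlog1 : 0 ≤ Real.log (2 * (n : ℝ) ^ 2 / δ) := by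
    refine Real.log_nonneg ((one_le_div hδ).2 ?_)
    nlinarith
  have hlog2 : 3 / 4 ≤ Real.log (4 / δ) := by
    have h1 := Real.one_sub_inv_le_log_of_pos (by positivity : 0 < 4 / δ)
    rw [inv_div] at h1
    linarith
  have hexp1 : Real.exp (-(2 * m * t ^ 2)) = δ / (2 * n ^ 2) := by
    rw [ht, Real.sq_sqrt (by positivity), mul_div_cancel₀ _ (by positivity), Real.exp_neg,
      Real.exp_log (by positivity), inv_div]
  have hsq : s ^ 2 = 8 * Real.log (4 / δ) / n := by
    rw [hs, Real.sq_sqrt (div_nonneg (by linarith) hn0.le)]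
  set B₁ : Set ((Fin n → Sph d) × (Fin m → Feat d) × (Fin m → ℤˣ)) :=
    {ω | ∃ i i', t ≤ |activationDeviation ω.2.1 (ω.1 i) (ω.1 i')|} with hB₁
  set B₂ : Set ((Fin n → Sph d) × (Fin m → Feat d) × (Fin m → ℤˣ)) :=
    {ω | n * s ≤ ‖∑ i, centredTensor ρ (ω.1 i)‖} with hB₂
  have hsub : {ω : (Fin n → Sph d) × (Fin m → Feat d) × (Fin m → ℤˣ) |
      ∀ k : ℕ, |arcSpectrum ρ k - Heig ω.2.2 ω.2.1 ω.1 k| ≤ t + s}ᶜ ⊆ B₁ ∪ B₂ := by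
    intro ω hω
    by_contra hB
    rw [Set.mem_union, not_or] at hB
    have h1 : ∀ i i', |activationDeviation ω.2.1 (ω.1 i) (ω.1 i')| ≤ t := fun i i' =>
      (not_le.1 fun h => hB.1 ⟨i, i', h⟩).le
    have h2 : ‖∑ i, centredTensor ρ (ω.1 i)‖ / n ≤ s := by
      rw [div_le_iff₀' hn0]
      exact (not_le.1 hB.2).le
    refine hω fun k => ?_
    have h3 := abs_arcSpectrum_sub_eigSeq_le ρ hn ω.1 k
    have h4 := abs_eigSeq_kernelMatrix_sub_Heig_le hn hm ω.2.2 ω.2.1 ω.1 ht0 h1 k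
    have h5 := abs_sub_le (arcSpectrum ρ k) (eigSeq (kernelMatrix_isHermitian ω.1) k)
      (Heig ω.2.2 ω.2.1 ω.1 k)
    linarith
  have hP₁ : jointLaw ρ ν n m B₁ ≤ ENNReal.ofReal ((n + 1) / (2 * n) * δ) := by
    refine (jointLaw_exists_activationDeviation_le ρ hν hm ht0).trans_eq ?_
    rw [hexp1]
    congr 1
    field_simp
  refine (measure_mono hsub).trans ((measure_union_le _ _).trans ?_)
  rcases hn.eq_or_lt with h1 | h2
  · -- The union bound over the single entry already costs `δ`, but for `n = 1` the bound on the
    -- feature tensor holds everywhere.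
    have hB : B₂ = ∅ := by
      refine Set.eq_empty_of_forall_notMem fun ω hω => ?_
      have h3 : (n : ℝ) * s ≤ ‖∑ i, centredTensor ρ (ω.1 i)‖ := hω
      have h4 : ‖∑ i, centredTensor ρ (ω.1 i)‖ ≤ 1 := by
        refine (norm_sum_le_of_le _ fun i _ => norm_centredTensor_le ρ (ω.1 i)).trans ?_
        simp [← h1]
      have h5 : (n : ℝ) = 1 := by exact_mod_cast h1.symm
      rw [h5, div_one] at hsq
      rw [h5, one_mul] at h3
      nlinarith
    rw [hB, measure_empty, add_zero]
    refine hP₁.trans (ENNReal.ofReal_le_ofReal ?_)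
    rw [← h1]
    norm_num
  · have h2' : (2 : ℝ) ≤ n := by exact_mod_cast h2
    have hexp2 : 2 * Real.exp (-n * s ^ 2 / 2) = 2 * (δ / 4) ^ 4 := by
      have e : -n * s ^ 2 / 2 = (4 : ℕ) * -Real.log (4 / δ) := by
        rw [hsq]
        push_cast
        field_simp
        ring
      rw [e, Real.exp_nat_mul, Real.exp_neg, Real.exp_log (by positivity), inv_div]
    have hP₂ : jointLaw ρ ν n m B₂ ≤ ENNReal.ofReal (δ / 4) := by
      refine (jointLaw_norm_sum_centredTensor_le ρ hs0).trans (ENNReal.ofReal_le_ofReal ?_)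
      rw [hexp2]
      have h3 : (δ / 4) ^ 3 ≤ (1 / 4) ^ 3 := by gcongr
      nlinarith
    refine (add_le_add hP₁ hP₂).trans ?_
    rw [← ENNReal.ofReal_add (by positivity) (by positivity)]
    refine ENNReal.ofReal_le_ofReal ?_
    have h4 : (n + 1 : ℝ) / (2 * n) ≤ 3 / 4 := by
      rw [div_le_div_iff₀ (by positivity) (by norm_num)]
      linarith
    nlinarith

/-! ### The smallest eigenvalue -/

theorem HeigMin_eq_Heig (hn : 1 ≤ n) (a : Fin m → ℤˣ) (w : Fin m → Feat d) (x : Fin n → Sph d) :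
    HeigMin a w x = Heig a w x (n - 1) := by
  have hlt : n - 1 < n := by omega
  have : Nonempty (Fin n) := ⟨⟨0, hn⟩⟩
  rw [HeigMin, Heig, dif_pos hlt]
  refine le_antisymm ?_ (le_ciInf fun i => ?_)
  · refine (ciInf_le (Set.finite_range _).bddBelow
      (Fintype.equivOfCardEq (Fintype.card_fin _) ⟨n - 1, by simpa using hlt⟩)).trans_eq ?_
    simp [Matrix.IsHermitian.eigenvalues]
  · refine (Hmat_isHermitian a w x).eigenvalues₀_antitone ?_
    rw [Fin.le_def]
    have h1 := ((Fintype.equivOfCardEq (Fintype.card_fin (Fintype.card (Fin n)))).symm i).2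
    simp only [Fintype.card_fin] at h1 ⊢
    omega

end Network

theorem tendsto_log_div_atTop {m : ℕ → ℕ}
    (hm : (fun n : ℕ => Real.log (n : ℝ)) =o[atTop] (fun n : ℕ => (m n : ℝ))) {δ : ℝ}
    (hδ : 0 < δ) :
    Tendsto (fun n : ℕ => Real.log (2 * (n : ℝ) ^ 2 / δ) / (2 * (m n : ℝ))) atTop (𝓝 0) := by
  have hc : (fun _ : ℕ => Real.log (2 / δ)) =o[atTop] (fun n : ℕ => (m n : ℝ)) :=
    (Real.isLittleO_const_log_atTop.comp_tendsto tendsto_natCast_atTop_atTop).trans hm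
  have h := (hc.tendsto_div_nhds_zero.div_const 2).add hm.tendsto_div_nhds_zero
  rw [zero_div, add_zero] at h
  refine h.congr' ?_
  filter_upwards [eventually_ge_atTop 1] with n hn
  have hn0 : (n : ℝ) ≠ 0 := by positivity
  rw [mul_div_right_comm, Real.log_mul (by positivity) (by positivity), Real.log_pow]
  push_cast
  rw [add_div, mul_div_mul_left _ _ (two_ne_zero), div_div, mul_comm (m n : ℝ) 2]

theorem eventually_one_le_of_isLittleO {m : ℕ → ℕ}
    (hm : (fun n : ℕ => Real.log (n : ℝ)) =o[atTop] (fun n : ℕ => (m n : ℝ))) :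
    ∀ᶠ n in atTop, 1 ≤ m n := by
  filter_upwards [hm.bound one_pos, eventually_ge_atTop 2] with n hn h2
  by_contra h
  have h0 : m n = 0 := by omega
  rw [h0] at hn
  have := Real.log_pos (by exact_mod_cast h2 : (1 : ℝ) < n)
  simp at hn
  rcases hn with h | h | h <;> first | omega | linarith

theorem theorem2 {d : ℕ} (ρ : Measure (Sph d)) [IsProbabilityMeasure ρ] :
    ∃ lam : ℕ → ℝ,
      Antitone lam ∧ (∀ i, 0 ≤ lam i) ∧ Tendsto lam atTop (𝓝 0) ∧
      IsSpectralSequence (arcOperator ρ) lam ∧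
      (∀ (n m : ℕ) (ν δ : ℝ), 1 ≤ n → 1 ≤ m → 0 < ν → 0 < δ → δ < 1 →
        ENNReal.ofReal (1 - δ) ≤ jointLaw ρ ν n m
          {ω | ∀ i : ℕ, |lam i - Heig ω.2.2 ω.2.1 ω.1 i| ≤
            Real.sqrt (Real.log (2 * (n : ℝ) ^ 2 / δ) / (2 * (m : ℝ))) +
              Real.sqrt (8 * Real.log (4 / δ) / (n : ℝ))}) ∧
      (∀ (m : ℕ → ℕ) (ν : ℕ → ℝ), (∀ n, 0 < ν n) →
        (fun n : ℕ => Real.log (n : ℝ)) =o[atTop] (fun n : ℕ => (m n : ℝ)) →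
        ∀ ε : ℝ, 0 < ε →
          Tendsto (fun n : ℕ => jointLaw ρ (ν n) n (m n)
            {ω | ε ≤ |HeigMin ω.2.2 ω.2.1 ω.1|}) atTop (𝓝 0)) := by
  have hspec := isSpectralSequence_arcSpectrum ρ
  refine ⟨arcSpectrum ρ, hspec.antitone, hspec.nonneg, hspec.tendsto_zero, hspec, ?_, ?_⟩
  · intro n m ν δ hn hm hν hδ hδ1
    have h := jointLaw_eigenvalue_deviation_le ρ hn hm hν hδ hδ1
    rw [ENNReal.ofReal_sub _ hδ.le, ENNReal.ofReal_one, tsub_le_iff_right]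
    refine le_trans ?_ (add_le_add_right h _)
    rw [← measure_univ (μ := jointLaw ρ ν n m)]
    exact measure_univ_le_add_compl _
  · intro m ν hν hm ε hε
    rw [ENNReal.tendsto_nhds_zero]
    intro η hη
    obtain ⟨δ, hδ, hδη⟩ : ∃ δ : ℝ, (0 < δ ∧ δ < 1) ∧ ENNReal.ofReal δ ≤ η := by
      have hne : min η (1 / 2) ≠ ⊤ := ne_top_of_le_ne_top (by simp) (min_le_right _ _)
      refine ⟨(min η (1 / 2)).toReal, ⟨ENNReal.toReal_pos ?_ hne, ?_⟩, ?_⟩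
      · exact (lt_min hη (by simp)).ne'
      · refine (ENNReal.toReal_mono (by simp) (min_le_right η (1 / 2))).trans_lt ?_
        norm_num
      · rw [ENNReal.ofReal_toReal hne]
        exact min_le_left _ _
    have hlim : Tendsto (fun n : ℕ => arcSpectrum ρ (n - 1) +
        (√(Real.log (2 * (n : ℝ) ^ 2 / δ) / (2 * (m n : ℝ))) +
          √(8 * Real.log (4 / δ) / (n : ℝ)))) atTop (𝓝 0) := by
      have h1 := hspec.tendsto_zero.comp (tendsto_sub_atTop_nat 1)
      have h2 := (tendsto_log_div_atTop hm hδ.1).sqrt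
      have h3 := (tendsto_const_div_atTop_nhds_zero_nat (8 * Real.log (4 / δ))).sqrt
      simpa using h1.add (h2.add h3)
    filter_upwards [hlim.eventually_lt_const hε, eventually_ge_atTop 1,
      eventually_one_le_of_isLittleO hm] with n hlt hn hmn
    refine (measure_mono ?_).trans
      ((jointLaw_eigenvalue_deviation_le ρ hn hmn (hν n) hδ.1 hδ.2).trans hδη)
    intro ω hω hgood
    have h1 : ε ≤ |HeigMin ω.2.2 ω.2.1 ω.1| := hω
    have h2 := hgood (n - 1)
    rw [HeigMin_eq_Heig hn] at h1
    have h3 := hspec.nonneg (n - 1)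
    have h4 := abs_sub_abs_le_abs_sub (Heig ω.2.2 ω.2.1 ω.1 (n - 1)) (arcSpectrum ρ (n - 1))
    rw [abs_sub_comm, abs_of_nonneg h3] at h4
    linarith
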